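/- For $n\ge 0$ let $\overline{\mathbb S}_n[0]$ be the set of finite sequences $s_0\dots s_{k-1}$ (including the empty sequence $\varepsilon$) over $\{0,\dots,n-1\}$ with $s_{i+1}\le s_i+1$ for all $i<k-1$ and, if $k>0$, $s_0=0$. Put $s_0\dots s_{k-1}\le^w_{gap}s'_0\dots s'_{l-1}$ if there is a strictly increasing $h:\{0,\dots,k-1\}\to\{0,\dots,l-1\}$ such that $s_i=s'_{h(i)}$ for all $i<k$, and $s'_j\ge s'_{h(i+1)}$ whenever $i<k-1$ and $h(i)<j<h(i+1)$. Put $s\le^s_{gap}s'$ if $h$ can be chosen such that, moreover, $s'_j\ge s'_{h(0)}$ for all $j<h(0)$ (when $k>0$). Consider terms built from $0$ by binary symbols $\overline\theta_i$ ($i\in\mathbb N$). Put $S0=-1$, $S\,\overline\theta_i\alpha\beta=i$; $K_j0=\emptyset$, $K_j\overline\theta_i\alpha\beta=K_j\alpha\cup K_j\beta$ if $j<i$, and $K_j\overline\theta_i\alpha\beta=\{\overline\theta_i\alpha\beta\}$ if $j\ge i$. Define $<$ recursively: $0<\overline\theta_i\alpha\beta$; no term is $<0$; and $\overline\theta_i\alpha\beta<\overline\theta_j\gamma\delta$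 iff $i<j$, or $i=j$ and one of the following holds: (a) $\alpha<\gamma$ and $\xi<\overline\theta_j\gamma\delta$ for all $\xi\in K_i\alpha\cup\{\beta\}$; (b) $\alpha=\gamma$ and $\beta<\delta$; (c) $\gamma<\alpha$ and $\overline\theta_i\alpha\beta\le\xi$ for all $\xi\in K_i\gamma\cup\{\delta\}$. Let $OT_n$ be the least set of terms that contains $0$ and contains $\overline\theta_i\alpha\beta$ whenever $\alpha,\beta\in OT_n$, $i<n$, $S\alpha\le i+1$, $S\beta\le i$ and $K_i\alpha=\emptyset$. Let $OT_n[0]=\{\alpha\in OT_n:\alpha<\overline\theta_1 00\}$. Define $f$ on finite sequences of natural numbers by $f(\varepsilon)=0$ and $f(i\,s)=\overline\theta_i\,f(s')\,f(s'')$, where $s'$ is the longest initial segment of $s$ all of whose entries are $>i$, and $s=s's''$. For a well-partial-order $(X,\le)$, its maximal order type $o(X,\le)$ is the supremum of the order types of the well-orders on $X$ that extend $\le$; a maximal linear extension is a well-order on $X$ that extends $\le$ and has order type $o(X,\le)$. Let $\omega_0=1$ and $\omega_{m+1}=\omega^{\omega_m}$ (ordinal exponentiation). **Corollary.** For every $n\ge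 0$, the relations $\le^w_{gap}$ and $\le^s_{gap}$ coincide on $\overline{\mathbb S}_n[0]$ and are a well-partial-order there; $f$ restricts to a bijection from $\overline{\mathbb S}_n[0]$ onto $OT_n[0]$; and, when $\overline{\mathbb S}_n[0]$ and $OT_n[0]$ are identified through $f$, the order $<$ on $OT_n[0]$ is a maximal linear extension of $\overline{\mathbb S}_n[0]$ with $\le^w_{gap}=\le^s_{gap}$. Thus $(OT_n[0],<)$ is a well-order with order type $o(\overline{\mathbb S}_n[0],\le^w_{gap})=o(\overline{\mathbb S}_n[0],\le^s_{gap})$, and for $n\ge1$ this ordinal is $\omega_{2n-1}$. -/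

import Mathlib

namespace GapTheta

/-! ### Well-partial-orders and maximal linear extensions -/

/-- A well-partial-order: a partial order `le` on `X` such that every infinite sequence
`x₀, x₁, …` has indices `i < j` with `le xᵢ xⱼ`. -/
def IsWPO {X : Type*} (le : X → X → Prop) : Prop :=
  IsPartialOrder X le ∧ WellQuasiOrdered le

/-- The partial order `le` is contained in the reflexive closure of the strict order `lt`. -/
def Extends {X : Type*} (le lt : X → X → Prop) : Prop :=
  ∀ x y, le x y → x = y ∨ lt x y

/-- The order types of all well-orders on `X` that extend `le`. A well-order is given by its
strict part `lt`. -/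
def extensionTypes {X : Type*} (le : X → X → Prop) : Set Ordinal :=
  {α | ∃ (lt : X → X → Prop) (_ : IsWellOrder X lt), Extends le lt ∧ Ordinal.type lt = α}

/-- The supremum in `maxOrderType` is a genuine one. -/
theorem bddAbove_extensionTypes {X : Type*} (le : X → X → Prop) :
    BddAbove (extensionTypes le) := by
  refine ⟨(Order.succ (Cardinal.mk X)).ord, ?_⟩
  rintro _ ⟨lt, _, _, rfl⟩
  apply le_of_lt
  rw [Cardinal.lt_ord, Ordinal.card_type]
  exact Order.lt_succ _

/-- The maximal order type `o(X, le)`. -/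
noncomputable def maxOrderType {X : Type*} (le : X → X → Prop) : Ordinal :=
  sSup (extensionTypes le)

/-- `lt` is (the strict part of) a maximal linear extension of `le`: a well-order on `X` that
extends `le` and whose order type is the maximal order type of `le`. -/
def IsMaximalLinearExtension {X : Type*} (le lt : X → X → Prop) : Prop :=
  ∃ _ : IsWellOrder X lt, Extends le lt ∧ Ordinal.type lt = maxOrderType le

/-- `omegaTower n α` is `ω_n[α]`: `ω_0[α] = α` and `ω_{n+1}[α] = ω ^ ω_n[α]`. -/
noncomputable def omegaTower : ℕ → Ordinal.{0} → Ordinal.{0}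
  | 0, α => α
  | n + 1, α => Ordinal.omega0 ^ omegaTower n α

/-! ### Gap-sequences -/

/-- `f` witnesses that `s` is weakly gap-embeddable into `t`. -/
structure IsWeakGapEmbedding (s t : List ℕ) (f : Fin s.length → Fin t.length) : Prop where
  strictMono : StrictMono f
  label : ∀ i, s.get i = t.get (f i)
  gap : ∀ (i : ℕ) (h : i + 1 < s.length) (j : Fin t.length),
    f ⟨i, Nat.lt_of_succ_lt h⟩ < j → j < f ⟨i + 1, h⟩ → t.get (f ⟨i + 1, h⟩) ≤ t.get j

/-- The weak gap-embeddability relation. -/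
def WeakGapLE (s t : List ℕ) : Prop :=
  ∃ f : Fin s.length → Fin t.length, IsWeakGapEmbedding s t f

/-- The strong gap-embeddability relation. -/
def StrongGapLE (s t : List ℕ) : Prop :=
  ∃ f : Fin s.length → Fin t.length, IsWeakGapEmbedding s t f ∧
    ∀ (h : 0 < s.length) (j : Fin t.length), j < f ⟨0, h⟩ → t.get (f ⟨0, h⟩) ≤ t.get j

/-- The finite sequences over `{0, …, n-1}` in which every entry is at most one more than the
entry before it. -/
def SBar (n : ℕ) : Set (List ℕ) :=
  {s | (∀ x ∈ s, x < n) ∧ s.IsChain (fun a b => b ≤ a + 1)}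

/-- The sequences in `SBar n` that are empty or whose first entry is at most `i`. -/
def SBarInit (n i : ℕ) : Set (List ℕ) :=
  {s ∈ SBar n | ∀ a ∈ s.head?, a ≤ i}

/-- The weak gap-embeddability relation on `SBarInit n i`. -/
def weakGap (n i : ℕ) (s t : SBarInit n i) : Prop := WeakGapLE s.1 t.1

/-- The strong gap-embeddability relation on `SBarInit n i`. -/
def strongGap (n i : ℕ) (s t : SBarInit n i) : Prop := StrongGapLE s.1 t.1

/-! ### Binary theta terms -/

/-- Terms built from `0` by binary function symbols `theta i`, `i ∈ ℕ`. -/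
inductive Term : Type
  | zero : Term
  | theta (i : ℕ) (α β : Term) : Term

namespace Term

/-- The index of the outermost function symbol; `-1` for the term `0`. -/
def S : Term → ℤ
  | zero => -1
  | theta i _ _ => i

/-- The sets `K_j α`. -/
def K (j : ℕ) : Term → Set Term
  | zero => ∅
  | theta i α β => if j < i then K j α ∪ K j β else {theta i α β}

/-- Number of function symbols in a term, used only for termination. -/
def size : Term → ℕ
  | zero => 0
  | theta _ α β => size α + size β + 1

theorem size_le_of_mem_K {j : ℕ} {x : Term} : ∀ {α : Term}, x ∈ K j α → size x ≤ size α
  | zero, h => by simp [K] at h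
  | theta i α β, h => by
    rw [K] at h
    split_ifs at h with hj
    · rcases h with h | h
      · have := size_le_of_mem_K h
        simp only [size]; omega
      · have := size_le_of_mem_K h
        simp only [size]; omega
    · rw [Set.mem_singleton_iff] at h
      rw [h]

/-- The order `<` on terms. -/
def Lt : Term → Term → Prop
  | _, zero => False
  | zero, theta _ _ _ => True
  | theta i α β, theta j γ δ =>
    i < j ∨ (i = j ∧
      ((Lt α γ ∧ (∀ ξ, ξ ∈ K i α → Lt ξ (theta j γ δ)) ∧ Lt β (theta j γ δ)) ∨
       (α = γ ∧ Lt β δ) ∨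
       (Lt γ α ∧ (∀ ξ, ξ ∈ K i γ → (theta i α β = ξ ∨ Lt (theta i α β) ξ)) ∧
         (theta i α β = δ ∨ Lt (theta i α β) δ))))
termination_by s t => size s + size t
decreasing_by
  all_goals first
    | (have hK := size_le_of_mem_K ‹_ ∈ K _ _›
       simp only [size] at *; omega)
    | (simp only [size]; omega)

end Term

open Term in
/-- The set `OT_n` of terms. -/
inductive OT (n : ℕ) : Term → Prop
  | zero : OT n zero
  | theta {i : ℕ} {α β : Term} (hα : OT n α) (hβ : OT n β) (hSα : S α ≤ (i : ℤ) + 1)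
      (hSβ : S β ≤ (i : ℤ)) (hi : i < n) (hK : K i α = ∅) : OT n (theta i α β)

/-- The set `OT_n[0]` of all terms in `OT_n` below `Ω₁ = theta 1 0 0`. -/
def OTZero (n : ℕ) : Set Term :=
  {α | OT n α ∧ Term.Lt α (Term.theta 1 Term.zero Term.zero)}

/-- The order `<` on `OT_n[0]`. -/
def otLt (n : ℕ) (α β : OTZero n) : Prop := Term.Lt α.1 β.1

/-- The map from sequences to terms: the empty sequence goes to `0`, and a sequence `i :: s` to
`theta i (f s₁) (f s₂)`, where `s₁` is the longest initial segment of `s` all of whose entries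
are greater than `i`, and `s = s₁ ++ s₂`. -/
def toTerm : List ℕ → Term
  | [] => Term.zero
  | i :: s =>
    Term.theta i (toTerm (s.takeWhile fun x => decide (i < x)))
      (toTerm (s.dropWhile fun x => decide (i < x)))
termination_by s => s.length
decreasing_by
  · exact Nat.lt_succ_of_le (List.takeWhile_prefix _).length_le
  · exact Nat.lt_succ_of_le (List.dropWhile_suffix _).length_le

end GapTheta

/-! Cut a sequence over `n + 1` letters in front of each of its zeros. Each block is a 0 followed by
positive entries, and these entries, lowered by one, form a sequence of the same kind over `n`
letters. So the domain for `n + 1` consists of the finite lists over the domain for `n`, and by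
induction it is the set `It n` of iterated lists over a point. Nonempty sequences start with 0, so
the extra condition of strong embeddings is void. A gap embedding can neither send a 0 to a positive
entry nor skip a 0 in search of a positive one; hence it sends blocks into blocks, and
gap-embeddability turns into Higman's order on lists (`It.sGap_seq_iff`).

The terms decompose in the same way: in a term of index 0 the first argument has empty `K 0`, so all
its indices are positive and it is a shifted term of the previous level. The conditions on `K` then
disappear from the comparison, and what is left is the recursion of the lexicographic path order on
lists (`Lpo.cons_iff`, `It.lt_term_iff`). The map `toTerm` matches the two codings
(`It.toTerm_seq`).

Higman's lemma gives the well-partial-order. The path order is total and extends it, hence is a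
well-order. For maximality, two bounds meet. If a level has type `α`, with `ω ≤ α < ε₀` here, every
linear extension of the Higman order on the next level has type at most `ω ^ ω ^ α`; this follows by
decomposing the elements not above a given one (`Meas.ind_list`, `Ind.type_le`). The path order
attains this value (`Lpo.le_typein_cons`). Lists over a point have type `ω`, and each further level
adds two exponentials. -/

namespace GapTheta

open Ordinal

/-! ### The natural sum of ordinals -/

/-- The natural (Hessenberg) sum of two ordinals. -/
noncomputable def natSum (a b : Ordinal.{u}) : Ordinal.{u} :=
  max (⨆ x : Set.Iio a, Order.succ (natSum x.1 b)) (⨆ x : Set.Iio b, Order.succ (natSum a x.1))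
termination_by (a, b)
decreasing_by
  · exact Prod.Lex.left _ _ x.2
  · exact Prod.Lex.right _ x.2

theorem natSum_lt_natSum_left {a a' : Ordinal.{u}} (h : a' < a) (b : Ordinal.{u}) :
    natSum a' b < natSum a b := by
  conv_rhs => rw [natSum]
  refine lt_max_of_lt_left ((Order.lt_succ _).trans_le ?_)
  exact Ordinal.le_iSup (fun x : Set.Iio a => Order.succ (natSum x.1 b)) ⟨a', h⟩

theorem natSum_lt_natSum_right (a : Ordinal.{u}) {b b' : Ordinal.{u}} (h : b' < b) :
    natSum a b' < natSum a b := by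
  conv_rhs => rw [natSum]
  refine lt_max_of_lt_right ((Order.lt_succ _).trans_le ?_)
  exact Ordinal.le_iSup (fun x : Set.Iio b => Order.succ (natSum a x.1)) ⟨b', h⟩

theorem natSum_le {a b c : Ordinal.{u}} (ha : ∀ a' < a, natSum a' b < c)
    (hb : ∀ b' < b, natSum a b' < c) : natSum a b ≤ c := by
  rw [natSum]
  refine max_le (Ordinal.iSup_le fun x => Order.succ_le_of_lt (ha _ x.2))
    (Ordinal.iSup_le fun x => Order.succ_le_of_lt (hb _ x.2))

theorem natSum_mono {a a' b b' : Ordinal.{u}} (ha : a' ≤ a) (hb : b' ≤ b) :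
    natSum a' b' ≤ natSum a b :=
  (monotone_iff_forall_lt.2 (fun _ _ h => (natSum_lt_natSum_left h b').le) ha).trans
    (monotone_iff_forall_lt.2 (fun _ _ h => (natSum_lt_natSum_right a h).le) hb)

theorem le_natSum_left (a b : Ordinal.{u}) : a ≤ natSum a b :=
  StrictMono.le_apply (f := fun x => natSum x b) fun _ _ h => natSum_lt_natSum_left h b

theorem le_natSum_right (a b : Ordinal.{u}) : b ≤ natSum a b :=
  StrictMono.le_apply (f := fun x => natSum a x) fun _ _ h => natSum_lt_natSum_right a h

theorem natSum_zero_zero : natSum (0 : Ordinal.{u}) 0 = 0 :=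
  le_antisymm (natSum_le (fun _ h => (not_lt_zero h).elim) fun _ h => (not_lt_zero h).elim)
    bot_le

theorem exists_eq_mul_natCast_add {o x y : Ordinal.{u}} {k : ℕ} (ho : 0 < o) (hy : y < o)
    (hx : x < o * k + y) :
    ∃ (k' : ℕ) (y' : Ordinal.{u}), y' < o ∧ x = o * k' + y' ∧ (k' < k ∨ k' = k ∧ y' < y) := by
  have hx' : x < o * (k + 1 : ℕ) := by
    push_cast
    rw [mul_add_one]
    exact hx.trans ((add_lt_add_iff_left _).2 hy)
  have hq : x / o < (k + 1 : ℕ) := (lt_mul_iff_div_lt ho.ne').1 hx'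
  obtain ⟨k', hk'⟩ := lt_omega0.1 (hq.trans (natCast_lt_omega0 _))
  refine ⟨k', x % o, mod_lt _ ho.ne', ?_, ?_⟩
  · rw [← hk', div_add_mod]
  · rw [hk'] at hq
    have hle : k' ≤ k := Nat.lt_succ_iff.1 (by exact_mod_cast hq)
    rcases hle.lt_or_eq with h | h
    · exact Or.inl h
    · refine Or.inr ⟨h, ?_⟩
      have := div_add_mod x o
      rw [hk', h] at this
      rw [← this] at hx
      exact (add_lt_add_iff_left _).1 hx

/-- Making an argument smaller lowers either its quotient by `o` or, at the same quotient, its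
remainder. Since `o` is closed under natural sums, the remainders never carry into the quotient. -/
theorem natSum_mul_natCast_add_le {o : Ordinal.{u}} (ho : 0 < o)
    (hp : ∀ a < o, ∀ b < o, natSum a b < o) (x x' : Ordinal.{u}) :
    ∀ (k m : ℕ) (y z : Ordinal.{u}), y < o → z < o → x = o * k + y → x' = o * m + z →
      natSum x x' ≤ o * (k + m : ℕ) + natSum y z := by
  have key : ∀ (i j : ℕ) (u v : Ordinal.{u}), i < j → u < o → o * i + u < o * j + v := by
    intro i j u v hij hu
    calc o * i + u < o * i + o := (add_lt_add_iff_left _).2 hu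
      _ = o * (i + 1 : ℕ) := by push_cast; rw [mul_add_one]
      _ ≤ o * j := by gcongr; exact hij
      _ ≤ o * j + v := le_self_add
  induction x using WellFoundedLT.induction generalizing x' with
  | ind x ihx =>
  induction x' using WellFoundedLT.induction with
  | ind x' ihx' =>
  intro k m y z hy hz hx hx'
  refine natSum_le (fun a ha => ?_) fun a ha => ?_
  · obtain ⟨k', y', hy', rfl, h⟩ := exists_eq_mul_natCast_add ho hy (hx ▸ ha)
    refine (ihx _ ha x' k' m y' z hy' hz rfl hx').trans_lt ?_
    rcases h with h | ⟨rfl, h⟩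
    · exact key _ _ _ _ (by omega) (hp _ hy' _ hz)
    · exact (add_lt_add_iff_left _).2 (natSum_lt_natSum_left h z)
  · obtain ⟨m', z', hz', rfl, h⟩ := exists_eq_mul_natCast_add ho hz (hx' ▸ ha)
    refine (ihx' _ ha k m' y z' hy hz' hx rfl).trans_lt ?_
    rcases h with h | ⟨rfl, h⟩
    · exact key _ _ _ _ (by omega) (hp _ hy _ hz')
    · exact (add_lt_add_iff_left _).2 (natSum_lt_natSum_right y h)

/-- Two ordinals below `ω ^ c` lie below finite multiples of one common power `ω ^ d` with `d < c`.
This power is closed by induction, so the multiples add up to a finite multiple. -/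
theorem natSum_lt_omega0_opow (c : Ordinal.{u}) :
    ∀ a < ω ^ c, ∀ b < ω ^ c, natSum a b < ω ^ c := by
  induction c using WellFoundedLT.induction with
  | ind c ih =>
  intro a ha b hb
  rcases eq_or_ne c 0 with rfl | hc
  · rw [opow_zero, Order.lt_one_iff] at ha hb
    rw [ha, hb, natSum_zero_zero, opow_zero]
    exact one_pos
  obtain ⟨c₁, h₁, n, hn⟩ := (lt_omega0_opow hc).1 ha
  obtain ⟨c₂, h₂, m, hm⟩ := (lt_omega0_opow hc).1 hb
  have hd : max c₁ c₂ < c := max_lt h₁ h₂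
  have hn' : a ≤ ω ^ max c₁ c₂ * n :=
    hn.le.trans (mul_le_mul_left (opow_le_opow_right omega0_pos (le_max_left _ _)) _)
  have hm' : b ≤ ω ^ max c₁ c₂ * m :=
    hm.le.trans (mul_le_mul_left (opow_le_opow_right omega0_pos (le_max_right _ _)) _)
  have hpos : 0 < ω ^ max c₁ c₂ := opow_pos _ omega0_pos
  refine (natSum_mono hn' hm').trans_lt ?_
  refine (natSum_mul_natCast_add_le hpos (ih _ hd) _ _ n m 0 0 hpos hpos
    (add_zero _).symm (add_zero _).symm).trans_lt ?_
  rw [natSum_zero_zero, add_zero]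
  exact (lt_omega0_opow hc).2 ⟨_, hd, n + m + 1, 
    mul_lt_mul_of_pos_left (by exact_mod_cast Nat.lt_succ_self (n + m)) hpos⟩

/-! ### Upper bounds for types of well-partial-orders -/

section Cover

variable {X Y : Type*} {le : X → X → Prop} {le' : Y → Y → Prop}

/-- `Cov le c A` says that `A` is a finite union of sets of type at most `ω ^ a` with `a < c`. Here
a set has type at most `ω ^ a` if for all of its elements `x` the set of its elements that are not
above `x` is, hereditarily, such a union for `a`. -/
inductive Cov (le : X → X → Prop) : Ordinal.{0} → Set X → Prop
  | empty (c : Ordinal.{0}) : Cov le c ∅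
  | of {a c : Ordinal.{0}} {A : Set X} (h : a < c) (hA : ∀ x ∈ A, Cov le a {y ∈ A | ¬ le x y}) :
      Cov le c A
  | union {c : Ordinal.{0}} {A B : Set X} (hA : Cov le c A) (hB : Cov le c B) : Cov le c (A ∪ B)

/-- The set `A` has type at most `ω ^ a`. -/
def Ind (le : X → X → Prop) (a : Ordinal.{0}) (A : Set X) : Prop :=
  ∀ x ∈ A, Cov le a {y ∈ A | ¬ le x y}

theorem Cov.subset {c : Ordinal.{0}} {A : Set X} (h : Cov le c A) :
    ∀ {B : Set X}, B ⊆ A → Cov le c B := by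
  induction h with
  | empty c =>
    intro B hB
    rw [Set.subset_empty_iff.1 hB]
    exact .empty c
  | of h _ ih =>
    exact fun hB => .of h fun x hx => ih x (hB hx) fun y hy => ⟨hB hy.1, hy.2⟩
  | @union c A A' _ _ ihA ihB =>
    intro B hB
    have : B = B ∩ A ∪ B ∩ A' := by
      rw [← Set.inter_union_distrib_left, Set.inter_eq_left.2 hB]
    rw [this]
    exact .union (ihA Set.inter_subset_right) (ihB Set.inter_subset_right)

theorem Ind.subset {a : Ordinal.{0}} {A B : Set X} (h : Ind le a A) (hB : B ⊆ A) : Ind le a B :=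
  fun x hx => (h x (hB hx)).subset fun _ hy => ⟨hB hy.1, hy.2⟩

theorem Cov.mono {c d : Ordinal.{0}} {A : Set X} (h : Cov le c A) (hcd : c ≤ d) : Cov le d A := by
  induction h with
  | empty c => exact .empty d
  | of h hA _ => exact .of (h.trans_le hcd) hA
  | union _ _ ihA ihB => exact .union (ihA hcd) (ihB hcd)

/-- A monotone map creates no new incomparabilities, so the elements of the image not above `φ x`
come from elements not above `x`. -/
theorem Cov.image {φ : X → Y} (hφ : ∀ x y, le x y → le' (φ x) (φ y)) {c : Ordinal.{0}}
    {A : Set X} (h : Cov le c A) : Cov le' c (φ '' A) := by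
  induction h with
  | empty c =>
    rw [Set.image_empty]
    exact .empty c
  | of h _ ih =>
    refine .of h ?_
    rintro _ ⟨x, hx, rfl⟩
    refine (ih x hx).subset ?_
    rintro _ ⟨⟨y, hy, rfl⟩, hxy⟩
    exact ⟨y, ⟨hy, fun hle => hxy (hφ _ _ hle)⟩, rfl⟩
  | union _ _ ihA ihB =>
    rw [Set.image_union]
    exact .union ihA ihB

/-- The product order. -/
def prodLE (le : X → X → Prop) (le' : Y → Y → Prop) (p q : X × Y) : Prop :=
  le p.1 q.1 ∧ le' p.2 q.2

/-- A pair that is not above `(x, y)` fails in one of the coordinates. This splits the residual into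
two products, each with one exponent lowered. -/
theorem Ind.prod {a b : Ordinal.{0}} {A : Set X} {B : Set Y} (hA : Ind le a A)
    (hB : Ind le' b B) : Ind (prodLE le le') (natSum a b) (A ×ˢ B) := by
  induction a using WellFoundedLT.induction generalizing b A B with
  | ind a iha =>
  induction b using WellFoundedLT.induction generalizing A B with
  | ind b ihb =>
  have left : ∀ {A' : Set X}, Cov le a A' → Cov (prodLE le le') (natSum a b) (A' ×ˢ B) := by
    intro A' h
    generalize ha : a = a' at h
    induction h with
    | empty =>
      rw [Set.empty_prod]
      exact .empty _
    | of h hA' _ =>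
      subst ha
      exact .of (natSum_lt_natSum_left h b) (iha _ h hA' hB)
    | union _ _ ih₁ ih₂ =>
      rw [Set.union_prod]
      exact .union (ih₁ ha) (ih₂ ha)
  have right : ∀ {B' : Set Y}, Cov le' b B' → Cov (prodLE le le') (natSum a b) (A ×ˢ B') := by
    intro B' h
    generalize hb : b = b' at h
    induction h with
    | empty =>
      rw [Set.prod_empty]
      exact .empty _
    | of h hB' _ =>
      subst hb
      exact .of (natSum_lt_natSum_right a h) (ihb _ h hA hB')
    | union _ _ ih₁ ih₂ =>
      rw [Set.prod_union]
      exact .union (ih₁ hb) (ih₂ hb)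
  rintro ⟨x, y⟩ ⟨hx, hy⟩
  refine (Cov.union (left (hA x hx)) (right (hB y hy))).subset ?_
  rintro ⟨x', y'⟩ ⟨⟨hx', hy'⟩, h⟩
  by_cases hxx : le x x'
  · exact Or.inr ⟨hx', hy', fun hyy => h ⟨hxx, hyy⟩⟩
  · exact Or.inl ⟨⟨hx', hxx⟩, hy'⟩

theorem Cov.prod {c : Ordinal.{0}} {A : Set X} {B : Set Y} (hA : Cov le (ω ^ c) A)
    (hB : Cov le' (ω ^ c) B) : Cov (prodLE le le') (ω ^ c) (A ×ˢ B) := by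
  generalize hd : ω ^ c = d at hA
  induction hA with
  | empty =>
    rw [Set.empty_prod]
    exact .empty _
  | of h hA ih =>
    clear ih
    subst hd
    generalize hd' : ω ^ c = d' at hB
    induction hB with
    | empty =>
      rw [Set.prod_empty]
      exact .empty _
    | of h' hB _ =>
      subst hd'
      exact .of (natSum_lt_omega0_opow c _ h _ h') (Ind.prod hA hB)
    | union _ _ ih₁ ih₂ =>
      rw [Set.prod_union]
      exact .union (ih₁ hd') (ih₂ hd')
  | union _ _ ih₁ ih₂ =>
    rw [Set.union_prod]
    exact .union (ih₁ hd) (ih₂ hd)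

/-- `Meas le α A` says that `A` is a finite union of sets whose types are bounded by powers of `ω`
with natural sum `α`. -/
inductive Meas (le : X → X → Prop) : Ordinal.{0} → Set X → Prop
  | empty : Meas le 0 ∅
  | of {a : Ordinal.{0}} {A : Set X} (hA : Ind le a A) : Meas le (ω ^ a) A
  | union {α β : Ordinal.{0}} {A B : Set X} (hA : Meas le α A) (hB : Meas le β B) :
      Meas le (natSum α β) (A ∪ B)

theorem Meas.subset {α : Ordinal.{0}} {A : Set X} (h : Meas le α A) :
    ∀ {B : Set X}, B ⊆ A → Meas le α B := by
  induction h with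
  | empty =>
    intro B hB
    rw [Set.subset_empty_iff.1 hB]
    exact .empty
  | of hA => exact fun hB => .of (hA.subset hB)
  | @union α β A A' _ _ ihA ihB =>
    intro B hB
    have : B = B ∩ A ∪ B ∩ A' := by
      rw [← Set.inter_union_distrib_left, Set.inter_eq_left.2 hB]
    rw [this]
    exact .union (ihA Set.inter_subset_right) (ihB Set.inter_subset_right)

theorem Cov.exists_meas {c : Ordinal.{0}} {A : Set X} (h : Cov le c A) :
    ∃ α < ω ^ c, Meas le α A := by
  induction h with
  | empty c => exact ⟨0, opow_pos _ omega0_pos, .empty⟩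
  | of h hA _ => exact ⟨_, (opow_lt_opow_iff_right one_lt_omega0).2 h, .of hA⟩
  | union _ _ ihA ihB =>
    obtain ⟨α, hα, hA⟩ := ihA
    obtain ⟨β, hβ, hB⟩ := ihB
    exact ⟨_, natSum_lt_omega0_opow _ _ hα _ hβ, .union hA hB⟩

theorem lt_omega0_opow_of_lt_epsilon_zero {α : Ordinal.{0}} (h : α < ε₀) : α < ω ^ α := by
  by_contra hα
  exact h.not_ge (epsilon_zero_le_of_omega0_opow_le (not_lt.1 hα))

/-- The exponents of the pieces must lie strictly below `ω ^ α`; the bound `ε₀` keeps `α` away from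
the fixed points of `ω ^ ·`. -/
theorem Meas.cov {α : Ordinal.{0}} {A : Set X} (h : Meas le α A) (hα : α < ε₀) :
    Cov le (ω ^ α) A := by
  induction h with
  | empty => exact .empty _
  | @of a A hA =>
    exact .of ((right_le_opow a one_lt_omega0).trans_lt
      (lt_omega0_opow_of_lt_epsilon_zero hα)) hA
  | @union α β A B _ _ ihA ihB =>
    have h₁ := le_natSum_left α β
    have h₂ := le_natSum_right α β
    exact .union ((ihA (h₁.trans_lt hα)).mono (opow_le_opow_right omega0_pos h₁))
      ((ihB (h₂.trans_lt hα)).mono (opow_le_opow_right omega0_pos h₂))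

/-- Only the pieces that contain `x` need to shrink; strict monotonicity of the natural sum makes a
single drop visible in the total. -/
theorem Meas.residual {α : Ordinal.{0}} {A : Set X} (h : Meas le α A) (x : X) :
    ∃ β ≤ α, Meas le β {y ∈ A | ¬ le x y} ∧ (x ∈ A → β < α) := by
  induction h with
  | empty => exact ⟨0, le_rfl, Meas.empty.subset fun _ h => h.1, fun h => h.elim⟩
  | @of a A hA =>
    by_cases hx : x ∈ A
    · obtain ⟨β, hβ, h⟩ := (hA x hx).exists_meas
      exact ⟨β, hβ.le, h, fun _ => hβ⟩
    · exact ⟨_, le_rfl, (Meas.of hA).subset fun _ h => h.1, fun h => (hx h).elim⟩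
  | @union α β A B _ _ ihA ihB =>
    obtain ⟨α', hα, hA, hA'⟩ := ihA
    obtain ⟨β', hβ, hB, hB'⟩ := ihB
    refine ⟨_, natSum_mono hα hβ, (hA.union hB).subset ?_, ?_⟩
    · rintro y ⟨hy | hy, hxy⟩
      exacts [Or.inl ⟨hy, hxy⟩, Or.inr ⟨hy, hxy⟩]
    · rintro (hx | hx)
      · exact (natSum_mono le_rfl hβ).trans_lt (natSum_lt_natSum_left (hA' hx) _)
      · exact (natSum_mono hα le_rfl).trans_lt (natSum_lt_natSum_right _ (hB' hx))

/-! ### Upper bound for Higman's order on lists -/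

theorem sublistForall₂_append {l₁ l₂ m₁ m₂ : List X} (h : l₁.SublistForall₂ le l₂)
    (h' : m₁.SublistForall₂ le m₂) : (l₁ ++ m₁).SublistForall₂ le (l₂ ++ m₂) := by
  induction h with
  | @nil l =>
    induction l with
    | nil => exact h'
    | cons _ _ ih => exact .cons_right ih
  | cons h _ ih => exact .cons h ih
  | cons_right _ ih => exact .cons_right ih

/-- Greedy matching: `z` is the first entry above `x`, and matching `x` with it leaves the most room
for `w`. -/
theorem exists_split_of_not_sublistForall₂ {x : X} {w l : List X}
    (h : ¬ (x :: w).SublistForall₂ le l) :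
    (∀ y ∈ l, ¬ le x y) ∨ ∃ l₁ z l₂, l = l₁ ++ z :: l₂ ∧ (∀ y ∈ l₁, ¬ le x y) ∧
      ¬ w.SublistForall₂ le l₂ := by
  induction l with
  | nil => exact Or.inl (by simp)
  | cons z l ih =>
    by_cases hz : le x z
    · exact Or.inr ⟨[], z, l, rfl, by simp, fun hw => h (.cons hz hw)⟩
    · rcases ih fun hl => h (.cons_right hl) with ih | ⟨l₁, z', l₂, rfl, h₁, h₂⟩
      · exact Or.inl (by simpa [hz] using ih)
      · exact Or.inr ⟨z :: l₁, z', l₂, rfl, by simpa [hz] using h₁, h₂⟩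

/-- The lists over a set of type at most `α` have type at most `ω ^ ω ^ α`. -/
theorem Meas.ind_list {α : Ordinal.{0}} (hα : α < ε₀) {A : Set X} (hA : Meas le α A) :
    Ind (List.SublistForall₂ le) (ω ^ α) {l | ∀ x ∈ l, x ∈ A} := by
  induction α using WellFoundedLT.induction generalizing A with
  | ind α ih =>
  intro w hw
  induction w with
  | nil => exact (Cov.empty _).subset fun l hl => hl.2 .nil
  | cons x w ihw =>
    obtain ⟨β, -, hβ, hβα⟩ := hA.residual x
    have hlt := hβα (hw x List.mem_cons_self)
    -- Removing the elements above `x` lowers the measure to `β < α`, so the outer induction applies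
    -- to lists over the remainder.
    have hres : Cov (List.SublistForall₂ le) (ω ^ α) {l | ∀ y ∈ l, y ∈ {y ∈ A | ¬ le x y}} :=
      .of ((opow_lt_opow_iff_right one_lt_omega0).2 hlt) (ih β hlt (hlt.trans hα) hβ)
    have hw' := ihw fun y hy => hw y (List.mem_cons_of_mem _ hy)
    -- The lists with an entry above `x` are covered by triples (list before it, the entry, list
    -- after it), mapped monotonically by concatenation.
    have hprod := (hres.prod ((hA.cov hα).prod hw')).image (le' := List.SublistForall₂ le)
      (φ := fun p => p.1 ++ p.2.1 :: p.2.2)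
      fun p q h => sublistForall₂_append h.1 (.cons h.2.1 h.2.2)
    refine (hres.union hprod).subset ?_
    rintro l ⟨hl, hxl⟩
    rcases exists_split_of_not_sublistForall₂ hxl with h | ⟨l₁, z, l₂, rfl, h₁, h₂⟩
    · exact Or.inl fun y hy => ⟨hl y hy, h y hy⟩
    · refine Or.inr ⟨(l₁, z, l₂), ⟨fun y hy => ⟨hl y (by simp [hy]), h₁ y hy⟩, hl z (by simp),
        fun y hy => hl y (by simp [hy]), h₂⟩, rfl⟩

end Cover

/-! ### Order types of linear extensions -/

section Types

variable {X : Type} (lt : X → X → Prop) [IsWellOrder X lt]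

/-- The order type of a subset of a well-order. -/
noncomputable def setType (A : Set X) : Ordinal.{0} := Ordinal.type (Subrel lt (· ∈ A))

theorem setType_mono {A B : Set X} (h : A ⊆ B) : setType lt A ≤ setType lt B :=
  Ordinal.type_le_iff'.2 ⟨⟨⟨Set.inclusion h, Set.inclusion_injective h⟩, Iff.rfl⟩⟩

theorem typein_eq_setType {A : Set X} (x : A) :
    typein (Subrel lt (· ∈ A)) x = setType lt {y ∈ A | lt y x} := by
  rw [← type_subrel]
  refine Quotient.sound ⟨⟨⟨fun y => ⟨y.1.1, y.1.2, y.2⟩, fun y => ⟨⟨y.1, y.2.1⟩, y.2.2⟩,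
    fun _ => rfl, fun _ => rfl⟩, Iff.rfl⟩⟩

theorem setType_lt {A : Set X} {x : X} (hx : x ∈ A) :
    setType lt {y ∈ A | lt y x} < setType lt A := by
  rw [← typein_eq_setType lt ⟨x, hx⟩]
  exact typein_lt_type _ _

theorem setType_le {A : Set X} {o : Ordinal.{0}}
    (h : ∀ x ∈ A, setType lt {y ∈ A | lt y x} < o) : setType lt A ≤ o := by
  refine le_of_forall_lt fun c hc => ?_
  obtain ⟨x, rfl⟩ := typein_surj _ hc
  rw [typein_eq_setType]
  exact h _ x.2

/-- An initial segment of the union is the union of segments of both parts, at least one of them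
proper, so induction on the two types applies. -/
theorem setType_union_le (A B : Set X) :
    setType lt (A ∪ B) ≤ natSum (setType lt A) (setType lt B) := by
  generalize hα : setType lt A = α
  induction α using WellFoundedLT.induction generalizing A B with
  | ind α ih =>
  generalize hβ : setType lt B = β
  induction β using WellFoundedLT.induction generalizing A B with
  | ind β ih' =>
  have hsep : ∀ x, {y ∈ A ∪ B | lt y x} = {y ∈ A | lt y x} ∪ {y ∈ B | lt y x} :=
    fun x => Set.sep_union
  have hAle : ∀ x, setType lt {y ∈ A | lt y x} ≤ α :=
    fun x => hα ▸ setType_mono lt fun _ h => h.1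
  have hBle : ∀ x, setType lt {y ∈ B | lt y x} ≤ β :=
    fun x => hβ ▸ setType_mono lt fun _ h => h.1
  refine setType_le lt ?_
  rintro x (hx | hx)
  · have hlt := hα ▸ setType_lt lt hx
    rw [hsep]
    exact (ih _ hlt _ _ rfl).trans_lt ((natSum_mono le_rfl (hBle x)).trans_lt
      (natSum_lt_natSum_left hlt β))
  · have hlt := hβ ▸ setType_lt lt hx
    rw [hsep]
    rcases (hAle x).lt_or_eq with h | h
    · exact (ih _ h _ _ rfl).trans_lt ((natSum_mono le_rfl (hBle x)).trans_lt
        (natSum_lt_natSum_left h β))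
    · exact (ih' _ hlt _ _ h rfl).trans_lt (natSum_lt_natSum_right α hlt)

variable {le : X → X → Prop}

/-- In a linear extension the predecessors of `x` are not above `x`, so they lie in the residual at
`x`, whose type is below `ω ^ a` by induction over its cover. -/
theorem Ind.setType_le {a : Ordinal.{0}} {A : Set X} (h : Ind le a A) (hext : Extends le lt) :
    setType lt A ≤ ω ^ a := by
  have hcov : ∀ {c : Ordinal.{0}} {A : Set X}, Cov le c A → setType lt A < ω ^ c := by
    intro c A h
    induction h with
    | empty c =>
      refine (GapTheta.setType_le lt ?_).trans_lt (opow_pos c omega0_pos)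
      simp
    | @of a c A h _ ih =>
      refine (GapTheta.setType_le lt fun x hx => ?_).trans_lt
        ((opow_lt_opow_iff_right one_lt_omega0).2 h)
      refine (setType_mono lt ?_).trans_lt (ih x hx)
      refine fun y hy => ⟨hy.1, fun hxy => ?_⟩
      rcases hext x y hxy with rfl | h'
      · exact irrefl_of lt _ hy.2
      · exact asymm_of lt h' hy.2
    | union _ _ ihA ihB =>
      exact (setType_union_le lt _ _).trans_lt (natSum_lt_omega0_opow _ _ ihA _ ihB)
  refine GapTheta.setType_le lt fun x hx => ?_
  refine (setType_mono lt ?_).trans_lt (hcov (h x hx))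
  refine fun y hy => ⟨hy.1, fun hxy => ?_⟩
  rcases hext x y hxy with rfl | h'
  · exact irrefl_of lt _ hy.2
  · exact asymm_of lt h' hy.2

theorem Ind.type_le {a : Ordinal.{0}} (h : Ind le a Set.univ) (hext : Extends le lt) :
    Ordinal.type lt ≤ ω ^ a := by
  refine le_trans ?_ (h.setType_le lt hext)
  exact type_le_iff'.2 ⟨⟨⟨fun x => ⟨x, trivial⟩, fun _ _ h => congrArg Subtype.val h⟩, Iff.rfl⟩⟩

end Types

/-! ### The lexicographic path order on lists -/

section Lpo

variable {X : Type} {r : X → X → Prop}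

/-- The lexicographic path order on lists, read as terms over unary function symbols with
precedence `r`. -/
inductive Lpo (r : X → X → Prop) : List X → List X → Prop
  | tail (c : X) (d : List X) : Lpo r d (c :: d)
  | of_lt_tail {c : X} {x d : List X} (h : Lpo r x d) : Lpo r x (c :: d)
  | of_lt_head {a c : X} {b d : List X} (h : r a c) (h' : Lpo r b (c :: d)) :
      Lpo r (a :: b) (c :: d)
  | of_eq_head {a : X} {b d : List X} (h : Lpo r b d) : Lpo r (a :: b) (a :: d)

theorem Lpo.trans [IsTrans X r] {x y z : List X} (h : Lpo r x y) (h' : Lpo r y z) :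
    Lpo r x z := by
  generalize hn : x.length + y.length + z.length = n
  induction n using Nat.strong_induction_on generalizing x y z with
  | _ n ih =>
  subst hn
  cases h' with
  | tail c d => exact .of_lt_tail h
  | of_lt_tail h' => exact .of_lt_tail (ih _ (by simp) h h' rfl)
  | @of_lt_head c e d f hce hd =>
    cases h with
    | tail => exact hd
    | of_lt_tail h => exact ih _ (by simp) h hd rfl
    | of_lt_head hac hb =>
      exact .of_lt_head (_root_.trans hac hce) (ih _ (by simp) hb (.of_lt_head hce hd) rfl)
    | of_eq_head hb => exact .of_lt_head hce (ih _ (by simp; omega) hb hd rfl)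
  | @of_eq_head c d f hd =>
    cases h with
    | tail => exact .of_lt_tail hd
    | of_lt_tail h => exact .of_lt_tail (ih _ (by simp; omega) h hd rfl)
    | of_lt_head hac hb =>
      exact .of_lt_head hac (ih _ (by simp) hb (.of_eq_head hd) rfl)
    | of_eq_head hb => exact .of_eq_head (ih _ (by simp; omega) hb hd rfl)

theorem Lpo.irrefl [IsTrans X r] [Std.Irrefl r] (x : List X) : ¬ Lpo r x x := by
  induction x with
  | nil => exact fun h => nomatch h
  | cons a b ih =>
    intro h
    cases h with
    | of_lt_tail h => exact ih ((Lpo.tail a b).trans h)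
    | of_lt_head h _ => exact irrefl_of r a h
    | of_eq_head h => exact ih h

theorem Lpo.nil_lt (a : X) (b : List X) : Lpo r [] (a :: b) := by
  induction b generalizing a with
  | nil => exact .tail a []
  | cons c d ih => exact .of_lt_tail (ih c)

theorem Lpo.trichotomy [IsTrans X r] (hr : ∀ a b, r a b ∨ a = b ∨ r b a) (x y : List X) :
    Lpo r x y ∨ x = y ∨ Lpo r y x := by
  induction x generalizing y with
  | nil =>
    cases y with
    | nil => exact Or.inr (Or.inl rfl)
    | cons c d => exact Or.inl (.nil_lt c d)
  | cons a b ihb =>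
    induction y with
    | nil => exact Or.inr (Or.inr (.nil_lt a b))
    | cons c d ihd =>
      rcases hr a c with h | rfl | h
      · rcases ihb (c :: d) with h' | rfl | h'
        · exact Or.inl (.of_lt_head h h')
        · exact Or.inr (Or.inr (.tail _ _))
        · exact Or.inr (Or.inr (.of_lt_tail h'))
      · rcases ihb d with h' | rfl | h'
        · exact Or.inl (.of_eq_head h')
        · exact Or.inr (Or.inl rfl)
        · exact Or.inr (Or.inr (.of_eq_head h'))
      · rcases ihd with h' | h' | h'
        · exact Or.inl (.of_lt_tail h')
        · rw [h']
          exact Or.inl (.tail _ _)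
        · exact Or.inr (Or.inr (.of_lt_head h h'))

/-- The recursion for the lexicographic path order that defines the order of the theta terms. -/
theorem Lpo.cons_iff [IsTrans X r] [Std.Irrefl r] (hr : ∀ a b, r a b ∨ a = b ∨ r b a)
    {a c : X} {b d : List X} :
    Lpo r (a :: b) (c :: d) ↔ (r a c ∧ Lpo r b (c :: d)) ∨ (a = c ∧ Lpo r b d) ∨
      (r c a ∧ (a :: b = d ∨ Lpo r (a :: b) d)) := by
  refine ⟨fun h => ?_, ?_⟩
  · rcases hr a c with hac | rfl | hac
    · exact Or.inl ⟨hac, (Lpo.tail a b).trans h⟩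
    · refine Or.inr (Or.inl ⟨rfl, ?_⟩)
      rcases trichotomy hr b d with h' | rfl | h'
      · exact h'
      · exact (Lpo.irrefl _ h).elim
      · exact (Lpo.irrefl _ (h.trans (.of_eq_head h'))).elim
    · refine Or.inr (Or.inr ⟨hac, ?_⟩)
      rcases trichotomy hr (a :: b) d with h' | h' | h'
      · exact Or.inr h'
      · exact Or.inl h'
      · exact (Lpo.irrefl _ (h.trans (.of_lt_head hac h'))).elim
  · rintro (⟨h, h'⟩ | ⟨rfl, h⟩ | ⟨-, rfl | h⟩)
    · exact .of_lt_head h h'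
    · exact .of_eq_head h
    · exact .tail _ _
    · exact .of_lt_tail h

theorem Lpo.extends {le : X → X → Prop} (hle : Extends le r) :
    Extends (List.SublistForall₂ le) (Lpo r) := by
  intro x y h
  induction h with
  | @nil l =>
    cases l with
    | nil => exact Or.inl rfl
    | cons a l => exact Or.inr (.nil_lt a l)
  | @cons a c b d hac _ ih =>
    have hb : Lpo r b (c :: d) := by
      rcases ih with rfl | h
      · exact .tail _ _
      · exact .of_lt_tail h
    rcases hle a c hac with rfl | h
    · rcases ih with rfl | h
      · exact Or.inl rfl
      · exact Or.inr (.of_eq_head h)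
    · exact Or.inr (.of_lt_head h hb)
  | @cons_right c x d _ ih =>
    rcases ih with rfl | h
    · exact Or.inr (.tail _ _)
    · exact Or.inr (.of_lt_tail h)

/-- A descending chain would contain a pair increasing in the well-quasi-order, and the path order
extends the latter. -/
theorem Lpo.isWellOrder [IsWellOrder X r] {le : X → X → Prop} (hle : Extends le r)
    (hw : WellQuasiOrdered (List.SublistForall₂ le)) : IsWellOrder (List X) (Lpo r) := by
  have htri := Lpo.trichotomy (r := r) fun a b => trichotomous_of r a b
  have hwf : WellFounded (Lpo r) := by
    rw [wellFounded_iff_isEmpty_descending_chain]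
    refine ⟨fun ⟨f, hf⟩ => ?_⟩
    have hlt : ∀ m n, m < n → Lpo r (f n) (f m) := by
      intro m n hmn
      induction hmn with
      | refl => exact hf m
      | step _ ih => exact (hf _).trans ih
    obtain ⟨m, n, hmn, hle'⟩ := hw f
    rcases Lpo.extends hle _ _ hle' with h | h
    · exact Lpo.irrefl (r := r) (f m) (by simpa [h] using hlt m n hmn)
    · exact Lpo.irrefl (r := r) _ (h.trans (hlt m n hmn))
  exact { wf := hwf, trichotomous := fun a b h h' => by
            rcases htri a b with h₁ | h₁ | h₁
            exacts [(h h₁).elim, h₁, (h' h₁).elim] }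

theorem Lpo.omega0_le_type [Nonempty X] [IsWellOrder (List X) (Lpo r)] :
    ω ≤ Ordinal.type (Lpo r) := by
  obtain ⟨a⟩ := ‹Nonempty X›
  have h : ∀ n : ℕ, (n : Ordinal.{0}) ≤ typein (Lpo r) (List.replicate n a) := by
    intro n
    induction n with
    | zero => exact bot_le
    | succ n ih =>
      push_cast
      exact Order.add_one_le_of_lt (ih.trans_lt ((typein_lt_typein _).2 (.tail a _)))
  exact omega0_le.2 fun n => (h n).trans (typein_lt_type _ _).le

/-! ### Lower bound for the lexicographic path order -/

section LowerBound

variable [IsWellOrder X r] [IsWellOrder (List X) (Lpo r)]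

/-- The lists below `α :: t` are closed under prefixing letters below `α`. Prefixing a letter at
position `ρ` multiplies positions by `ω ^ ω ^ ρ'` for each `ρ' < ρ`, by induction, and iterating
this exhausts `ω ^ ω ^ ρ`. -/
theorem Lpo.le_typein_cons {ρ : Ordinal.{0}} {α : X} (hα : ρ < typein r α) (t : List X) :
    ω ^ ω ^ ρ * (1 + typein (Lpo r) t) ≤ typein (Lpo r) (α :: t) := by
  set o : List X → Ordinal.{0} := fun t => typein (Lpo r) t
  have omono : ∀ {s t : List X}, Lpo r s t → o s < o t := fun h => (typein_lt_typein _).2 h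
  change ω ^ ω ^ ρ * (1 + o t) ≤ o (α :: t)
  induction ρ using WellFoundedLT.induction generalizing α t with
  | ind ρ ihρ =>
  -- Strictness of `hα` leaves room for a letter `γ` at position exactly `ρ` below `α`; it is the
  -- letter to be prefixed.
  obtain ⟨γ, hγ⟩ := typein_surj r (hα.trans (typein_lt_type r α))
  have hγα : r γ α := (typein_lt_typein r).1 (hγ ▸ hα)
  have hpos : (0 : Ordinal.{0}) < ω ^ ω ^ ρ := opow_pos _ omega0_pos
  have hlim : Order.IsSuccLimit (ω ^ ω ^ ρ : Ordinal.{0}) :=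
    isSuccLimit_opow_left isSuccLimit_omega0 (opow_pos _ omega0_pos).ne'
  have hcons : ∀ {s t}, Lpo r s (α :: t) → Lpo r (γ :: s) (α :: t) := fun h => .of_lt_head hγα h
  -- below `α :: t` one can add anything below `ω ^ ω ^ ρ`
  have step : ∀ t s, Lpo r s (α :: t) → ∀ σ : Ordinal.{0}, ω ^ ω ^ ρ * σ ≤ o s →
      ω ^ ω ^ ρ * (σ + 1) ≤ o (α :: t) := by
    intro t s hs σ hσ
    have hs' : ∀ δ < (ω ^ ω ^ ρ : Ordinal.{0}), ∃ s', Lpo r s' (α :: t) ∧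
        ω ^ ω ^ ρ * σ + δ ≤ o s' := by
      have hsucc : ∀ s σ', Lpo r s (α :: t) → σ' ≤ o s →
          Lpo r (γ :: s) (α :: t) ∧ σ' + 1 ≤ o (γ :: s) := fun s σ' h h' =>
        ⟨hcons h, Order.add_one_le_of_lt (h'.trans_lt (omono (.tail _ _)))⟩
      rcases eq_or_ne ρ 0 with rfl | hρ
      · intro δ hδ
        rw [opow_zero, opow_one] at hδ
        obtain ⟨n, rfl⟩ := lt_omega0.1 hδ
        clear hδ
        induction n with
        | zero => exact ⟨s, hs, by simpa using hσ⟩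
        | succ n ih =>
          obtain ⟨s', hs', h⟩ := ih
          have := hsucc _ _ hs' h
          exact ⟨_, this.1, by push_cast; rw [← add_assoc]; exact this.2⟩
      · intro δ hδ
        obtain ⟨ρ', hρ', n, hn⟩ : ∃ ρ' < ρ, ∃ n : ℕ, δ < ω ^ (ω ^ ρ' * n) := by
          obtain ⟨c, hc, hδc⟩ := (lt_opow_of_isSuccLimit omega0_ne_zero
            (isSuccLimit_opow_left isSuccLimit_omega0 hρ)).1 hδ
          obtain ⟨ρ', hρ', n, hn⟩ := (lt_omega0_opow hρ).1 hc
          exact ⟨ρ', hρ', n, hδc.trans ((opow_lt_opow_iff_right one_lt_omega0).2 hn)⟩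
        have hmul : ∀ s, ω ^ ω ^ ρ' * o s ≤ o (γ :: s) := fun s =>
          le_trans (by gcongr; exact le_add_self) (ihρ ρ' hρ' (hγ ▸ hρ') s)
        -- The first `γ` adds 1 and `n` more multiply by `ω ^ (ω ^ ρ' * n)`. This factor is absorbed
        -- by `ω ^ ω ^ ρ`, but it turns the added 1 into a bound for `δ`.
        have hiter : ∀ n : ℕ, ∃ s', Lpo r s' (α :: t) ∧
            ω ^ (ω ^ ρ' * n) * (ω ^ ω ^ ρ * σ + 1) ≤ o s' := by
          intro n
          induction n with
          | zero =>
            have := hsucc _ _ hs hσ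
            exact ⟨_, this.1, by simpa using this.2⟩
          | succ n ih =>
            obtain ⟨s', hs', h⟩ := ih
            refine ⟨_, hcons hs', le_trans ?_ (hmul s')⟩
            refine le_trans (le_of_eq ?_) (mul_le_mul_right h _)
            rw [← mul_assoc, ← opow_add]
            congr 2
            have : ((n + 1 : ℕ) : Ordinal.{0}) = 1 + n := by
              rw [add_comm n 1]; push_cast; rfl
            rw [this, mul_add, mul_one]
        obtain ⟨s', hs', h⟩ := hiter n
        refine ⟨s', hs', le_trans ?_ h⟩
        rw [mul_add_one, ← mul_assoc, ← opow_add,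
          (isPrincipal_add_omega0_opow ρ).add_eq_right]
        · gcongr
        · exact (lt_omega0_opow (pos_iff_ne_zero.1 (bot_le.trans_lt hρ'))).2 ⟨ρ', hρ', n + 1,
            mul_lt_mul_of_pos_left (by exact_mod_cast Nat.lt_succ_self n)
              (opow_pos _ omega0_pos)⟩
    refine le_of_forall_lt fun c hc => ?_
    rw [mul_add_one, lt_add_iff_of_isSuccLimit hlim] at hc
    obtain ⟨δ, hδ, hc⟩ := hc
    obtain ⟨s', hs', h⟩ := hs' δ hδ
    exact hc.trans_le (h.trans (omono hs').le)
  induction t using (inferInstance : IsWellFounded (List X) (Lpo r)).induction with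
  | ind t iht =>
  refine le_of_forall_lt fun c hc => ?_
  rw [lt_mul_iff] at hc
  obtain ⟨q, hq, d, hd, rfl⟩ := hc
  -- The value `q = 0` starts from the empty list, which accounts for the summand 1; `q = 1 + q'`
  -- starts from `α :: t'` with `t'` at position `q'`.
  have : ω ^ ω ^ ρ * (q + 1) ≤ o (α :: t) := by
    rcases eq_or_ne q 0 with rfl | hq0
    · exact step t [] (.nil_lt _ _) 0 (by simp)
    · obtain ⟨q', rfl⟩ := exists_add_of_le (Order.one_le_iff_pos.2 (pos_iff_ne_zero.2 hq0))
      have hq' : q' < o t := (add_lt_add_iff_left _).1 hq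
      obtain ⟨t', rfl⟩ := typein_surj (Lpo r) (hq'.trans (typein_lt_type _ t))
      have ht' : Lpo r t' t := (typein_lt_typein _).1 hq'
      exact step t _ (.of_eq_head ht') _ (iht t' ht')
  refine lt_of_lt_of_le ?_ this
  rw [mul_add_one]
  exact (add_lt_add_iff_left _).2 hd

theorem Lpo.omega0_opow_le_type (h : Order.IsSuccLimit (Ordinal.type r)) :
    ω ^ ω ^ Ordinal.type r ≤ Ordinal.type (Lpo r) := by
  refine le_of_forall_lt fun c hc => ?_
  obtain ⟨d, hd, hc⟩ := (lt_opow_of_isSuccLimit omega0_ne_zero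
    (isSuccLimit_opow_left isSuccLimit_omega0 h.bot_lt.ne')).1 hc
  obtain ⟨ρ, hρ, hd⟩ := (lt_opow_of_isSuccLimit omega0_ne_zero h).1 hd
  -- The limit hypothesis provides a letter at position `ρ + 1`, which absorbs the strict inequality
  -- in `Lpo.le_typein_cons`.
  obtain ⟨α, hα⟩ := typein_surj r (h.succ_lt hρ)
  have hle := Lpo.le_typein_cons (hα ▸ Order.lt_succ ρ) []
  refine hc.trans_le (le_trans ?_ (hle.trans (typein_lt_type _ _).le))
  refine le_trans (opow_le_opow_right omega0_pos hd.le) ?_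
  exact le_mul_of_one_le_right' le_self_add

end LowerBound

end Lpo

/-! ### Iterated lists -/

/-- The type of `n` times iterated finite lists over a point. -/
def It : ℕ → Type
  | 0 => PUnit
  | n + 1 => List (It n)

/-- The iterated Higman order. -/
def It.le : (n : ℕ) → It n → It n → Prop
  | 0 => fun _ _ => True
  | n + 1 => List.SublistForall₂ (It.le n)

/-- The iterated lexicographic path order. -/
def It.lt : (n : ℕ) → It n → It n → Prop
  | 0 => fun _ _ => False
  | n + 1 => Lpo (It.lt n)

namespace It

theorem isPreorder_le (n : ℕ) : IsPreorder (It n) (le n) := by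
  induction n with
  | zero => exact { refl := fun _ => trivial, trans := fun _ _ _ _ _ => trivial }
  | succ n ih =>
    exact { refl := (List.SublistForall₂.is_refl (Rₐ := le n)).refl
            trans := (List.SublistForall₂.is_trans (Rₐ := le n)).trans }

theorem wellQuasiOrdered_le (n : ℕ) : WellQuasiOrdered (le n) := by
  induction n with
  | zero => exact fun f => ⟨0, 1, Nat.zero_lt_one, trivial⟩
  | succ n ih =>
    have := isPreorder_le n
    have h := Set.PartiallyWellOrderedOn.partiallyWellOrderedOn_sublistForall₂ (le n)
      (Set.partiallyWellOrderedOn_univ_iff.2 ih)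
    have huniv : {l : List (It n) | ∀ x, x ∈ l → x ∈ Set.univ} = Set.univ := by simp
    rw [huniv] at h
    exact Set.partiallyWellOrderedOn_univ_iff.1 h

theorem extends_lt (n : ℕ) : Extends (le n) (lt n) := by
  induction n with
  | zero => exact fun _ _ _ => Or.inl rfl
  | succ n ih => exact Lpo.extends ih

instance isWellOrder_lt (n : ℕ) : IsWellOrder (It n) (lt n) := by
  induction n with
  | zero => exact { wf := ⟨fun a => ⟨a, fun _ h => h.elim⟩⟩, trichotomous := fun _ _ _ _ => rfl }
  | succ n ih => exact Lpo.isWellOrder (extends_lt n) (wellQuasiOrdered_le (n + 1))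

theorem antisymm_le {n : ℕ} {x y : It n} (h : le n x y) (h' : le n y x) : x = y := by
  rcases extends_lt n x y h with h₁ | h₁
  · exact h₁
  · rcases extends_lt n y x h' with h₂ | h₂
    · exact h₂.symm
    · exact (asymm_of (lt n) h₁ h₂).elim

/-- The exponent of the type of `It n`. -/
noncomputable def exponent : ℕ → Ordinal.{0}
  | 0 => 0
  | n + 1 => omegaTower (2 * n) 1

theorem omegaTower_lt_epsilon_zero (k : ℕ) : omegaTower k 1 < ε₀ := by
  induction k with
  | zero => exact_mod_cast natCast_lt_epsilon 1 0
  | succ k ih =>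
    rw [omegaTower, ← omega0_opow_epsilon 0]
    exact (opow_lt_opow_iff_right one_lt_omega0).2 ih

theorem omega0_opow_exponent (n : ℕ) : ω ^ exponent (n + 1) = omegaTower (2 * (n + 1) - 1) 1 := rfl

theorem sublistForall₂_of_length_le {X : Type} {le : X → X → Prop} (h : ∀ x y, le x y)
    {l m : List X} (hlm : l.length ≤ m.length) : l.SublistForall₂ le m := by
  induction l generalizing m with
  | nil => exact .nil
  | cons x l ih =>
    cases m with
    | nil => simp at hlm
    | cons y m => exact .cons (h x y) (ih (by simpa using hlm))

theorem cov_length_lt {X : Type} {le : X → X → Prop} (h : ∀ x y, le x y) (k : ℕ) :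
    Cov (List.SublistForall₂ le) 1 {l | l.length < k} := by
  induction k with
  | zero => exact (Cov.empty _).subset fun l hl => (Nat.not_lt_zero _ hl).elim
  | succ k ih =>
    have hk : Cov (List.SublistForall₂ le) 1 {l | l.length = k} := by
      refine .of zero_lt_one fun x hx => (Cov.empty _).subset fun y hy => hy.2 ?_
      exact sublistForall₂_of_length_le h (le_of_eq (hx.trans hy.1.symm))
    refine (ih.union hk).subset fun l hl => ?_
    exact (Nat.lt_succ_iff_lt_or_eq.1 hl)

theorem ind_univ (n : ℕ) : Ind (le n) (exponent n) Set.univ := by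
  induction n with
  | zero => exact fun x _ => (Cov.empty _).subset fun y hy => hy.2 trivial
  | succ n ih =>
    cases n with
    | zero =>
      -- Over a point the general bound for lists would give `ω ^ ω`; classifying lists by their
      -- length gives the sharp value `ω`.
      intro x _
      refine (cov_length_lt (le := le 0) (fun _ _ => trivial) (List.length x)).subset fun y hy => ?_
      exact not_le.1 fun hxy => hy.2 (sublistForall₂_of_length_le (fun _ _ => trivial) hxy)
    | succ n =>
      have := (Meas.of ih).ind_list (omegaTower_lt_epsilon_zero (2 * n + 1))
      exact this.subset fun l _ x _ => trivial

theorem type_le_of_extends (n : ℕ) (r : It n → It n → Prop) [IsWellOrder (It n) r]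
    (h : Extends (le n) r) : Ordinal.type r ≤ ω ^ exponent n :=
  (ind_univ n).type_le r h

theorem type_lt (n : ℕ) : Ordinal.type (lt n) = ω ^ exponent n := by
  refine le_antisymm (type_le_of_extends n _ (extends_lt n)) ?_
  induction n with
  | zero =>
    have : Nonempty (It 0) := ⟨PUnit.unit⟩
    rw [exponent, opow_zero, Order.one_le_iff_pos, pos_iff_ne_zero, Ne, type_eq_zero_iff_isEmpty,
      not_isEmpty_iff]
    exact this
  | succ n ih =>
    have : IsWellOrder (List (It n)) (Lpo (lt n)) := isWellOrder_lt (n + 1)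
    cases n with
    | zero =>
      have : Nonempty (It 0) := ⟨PUnit.unit⟩
      rw [exponent, omegaTower, opow_one]
      exact Lpo.omega0_le_type (r := lt 0)
    | succ n =>
      have h : Ordinal.type (lt (n + 1)) = ω ^ exponent (n + 1) :=
        le_antisymm (type_le_of_extends _ _ (extends_lt _)) ih
      have hlim : Order.IsSuccLimit (Ordinal.type (lt (n + 1))) := by
        rw [h]
        refine isSuccLimit_opow_left isSuccLimit_omega0 ?_
        cases n with
        | zero => exact one_ne_zero
        | succ n => exact (opow_pos _ omega0_pos).ne'
      refine le_trans (le_of_eq ?_) (Lpo.omega0_opow_le_type (r := lt (n + 1)) hlim)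
      rw [h]
      rfl

end It

/-! ### Gap-embeddability -/

/-- Strong gap-embeddability, generated by its rules. -/
inductive SGap : List ℕ → List ℕ → Prop
  | nil (t : List ℕ) : SGap [] t
  | cons (a : ℕ) {s t : List ℕ} (h : SGap s t) : SGap (a :: s) (a :: t)
  | skip {a b : ℕ} (hab : a ≤ b) {s t : List ℕ} (h : SGap (a :: s) t) : SGap (a :: s) (b :: t)

theorem SGap.strongGapLE {s t : List ℕ} (h : SGap s t) : StrongGapLE s t := by
  induction h with
  | nil t =>
    exact ⟨fun i => i.elim0, ⟨fun i => i.elim0, fun i => i.elim0,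
      fun i h => (Nat.not_lt_zero _ h).elim⟩, fun h => (Nat.not_lt_zero _ h).elim⟩
  | @cons a s t _ ih =>
    obtain ⟨f, hf, hstr⟩ := ih
    refine ⟨Fin.cases 0 fun i => (f i).succ, ⟨?_, ?_, ?_⟩, ?_⟩
    · intro i j hij
      induction j using Fin.cases with
      | zero => exact (Fin.not_lt_zero _ hij).elim
      | succ j =>
        induction i using Fin.cases with
        | zero => exact Fin.succ_pos _
        | succ i => exact Fin.succ_lt_succ_iff.2 (hf.strictMono (Fin.succ_lt_succ_iff.1 hij))
    · intro i
      induction i using Fin.cases with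
      | zero => rfl
      | succ i => exact hf.label i
    · intro i h j hj hj'
      induction j using Fin.cases with
      | zero => exact (Fin.not_lt_zero _ hj).elim
      | succ j =>
        cases i with
        | zero => exact hstr (Nat.lt_of_succ_lt_succ h) j (Fin.succ_lt_succ_iff.1 hj')
        | succ i =>
          exact hf.gap i (Nat.lt_of_succ_lt_succ h) j (Fin.succ_lt_succ_iff.1 hj)
            (Fin.succ_lt_succ_iff.1 hj')
    · exact fun h j hj => (Fin.not_lt_zero _ hj).elim
  | @skip a b hab s t _ ih =>
    obtain ⟨f, hf, hstr⟩ := ih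
    refine ⟨fun i => (f i).succ, ⟨?_, ?_, ?_⟩, ?_⟩
    · exact fun i j hij => Fin.succ_lt_succ_iff.2 (hf.strictMono hij)
    · exact fun i => hf.label i
    · intro i h j hj hj'
      induction j using Fin.cases with
      | zero => exact (Fin.not_lt_zero _ hj).elim
      | succ j => exact hf.gap i h j (Fin.succ_lt_succ_iff.1 hj) (Fin.succ_lt_succ_iff.1 hj')
    · intro h j hj
      induction j using Fin.cases with
      | zero =>
        refine le_trans (le_of_eq ?_) hab
        exact (hf.label ⟨0, h⟩).symm
      | succ j => exact hstr h j (Fin.succ_lt_succ_iff.1 hj)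

theorem StrongGapLE.sGap {s t : List ℕ} (h : StrongGapLE s t) : SGap s t := by
  induction t generalizing s with
  | nil =>
    cases s with
    | nil => exact .nil _
    | cons a s =>
      obtain ⟨f, -⟩ := h
      exact (f ⟨0, Nat.succ_pos _⟩).elim0
  | cons b t ih =>
    cases s with
    | nil => exact .nil _
    | cons a s =>
      obtain ⟨f, hf, hstr⟩ := h
      have hpos : 0 < (a :: s).length := Nat.succ_pos _
      -- If the head of the target is hit, removing both heads turns the first gap condition into
      -- the initial condition of a strong embedding. Otherwise the initial condition allows the
      -- head to be skipped.
      by_cases h0 : f ⟨0, hpos⟩ = ⟨0, Nat.succ_pos _⟩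
      · have hab : a = b := by
          have := hf.label ⟨0, hpos⟩
          rw [h0] at this
          exact this
        subst hab
        have hlt : ∀ i : Fin s.length, f ⟨0, hpos⟩ < f i.succ := fun i =>
          hf.strictMono (Fin.succ_pos i)
        have hne : ∀ i : Fin s.length, f i.succ ≠ 0 := fun i h => by
          have := hlt i
          rw [h] at this
          exact Fin.not_lt_zero _ this
        refine .cons a (ih ⟨fun i => (f i.succ).pred (hne i), ⟨?_, ?_, ?_⟩, ?_⟩)
        · exact fun i j hij => Fin.pred_lt_pred_iff.2 (hf.strictMono (Fin.succ_lt_succ_iff.2 hij))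
        · intro i
          have := hf.label i.succ
          rw [← Fin.succ_pred (f i.succ) (hne i)] at this
          exact this
        · intro i h j hj hj'
          have := hf.gap (i + 1) (Nat.succ_lt_succ h) j.succ (Fin.pred_lt_iff _ |>.1 hj)
            (Fin.lt_pred_iff _ |>.1 hj')
          refine le_trans (le_of_eq ?_) this
          conv_rhs => rw [← Fin.succ_pred (f ⟨i + 1 + 1, Nat.succ_lt_succ h⟩) (hne ⟨i + 1, h⟩)]
          rfl
        · intro h j hj
          have := hf.gap 0 (Nat.succ_lt_succ h) j.succ (by rw [h0]; exact Fin.succ_pos j)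
            (Fin.lt_pred_iff _ |>.1 hj)
          refine le_trans (le_of_eq ?_) this
          conv_rhs => rw [← Fin.succ_pred (f ⟨0 + 1, Nat.succ_lt_succ h⟩) (hne ⟨0, h⟩)]
          rfl
      · have hne : ∀ i, f i ≠ 0 := fun i h => h0 <| by
          have h₁ : f ⟨0, hpos⟩ ≤ f i := hf.strictMono.monotone (Fin.zero_le i)
          rw [h] at h₁
          exact Fin.le_zero_iff.1 h₁
        have hlab : ∀ i, (a :: s).get i = t.get ((f i).pred (hne i)) := by
          intro i
          have := hf.label i
          rw [← Fin.succ_pred (f i) (hne i)] at this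
          exact this
        refine .skip ?_ (ih ⟨fun i => (f i).pred (hne i), ⟨?_, hlab, ?_⟩, ?_⟩)
        · have := hstr hpos 0 (Fin.pos_iff_ne_zero.2 h0)
          rw [← hf.label] at this
          exact this
        · exact fun i j hij => Fin.pred_lt_pred_iff.2 (hf.strictMono hij)
        · intro i h j hj hj'
          have := hf.gap i h j.succ (Fin.pred_lt_iff _ |>.1 hj) (Fin.lt_pred_iff _ |>.1 hj')
          rw [← hf.label] at this
          rw [← hlab]
          exact this
        · intro h j hj
          have := hstr h j.succ (Fin.lt_pred_iff _ |>.1 hj)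
          rw [← hf.label] at this
          rw [← hlab]
          exact this

theorem strongGapLE_iff_sGap {s t : List ℕ} : StrongGapLE s t ↔ SGap s t :=
  ⟨StrongGapLE.sGap, SGap.strongGapLE⟩

theorem weakGapLE_iff_strongGapLE {s t : List ℕ} (hs : ∀ a ∈ s.head?, a ≤ 0) :
    WeakGapLE s t ↔ StrongGapLE s t := by
  refine ⟨fun ⟨f, hf⟩ => ⟨f, hf, fun h j _ => ?_⟩, fun ⟨f, hf, _⟩ => ⟨f, hf⟩⟩
  rw [← hf.label]
  cases s with
  | nil => exact (Nat.not_lt_zero _ h).elim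
  | cons a s => exact (hs a rfl).trans (Nat.zero_le _)

theorem SGap.refl (s : List ℕ) : SGap s s := by
  induction s with
  | nil => exact .nil _
  | cons a s ih => exact .cons a ih

/-- Whatever is left of `v` after embedding `u` may be skipped, because the next entry to be placed
is 0. -/
theorem SGap.append {u v s t : List ℕ} (h : SGap u v) (hs : ∀ a ∈ s.head?, a = 0)
    (hst : SGap s t) : SGap (u ++ s) (v ++ t) := by
  induction h with
  | nil v =>
    induction v with
    | nil => exact hst
    | cons b v ih =>
      cases s with
      | nil => exact .nil _
      | cons a s => exact .skip ((hs a rfl).trans_le (Nat.zero_le b)) ih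
  | cons a _ ih => exact .cons a ih
  | skip hab _ ih => exact .skip hab ih

/-- A positive entry of `u` cannot pass the 0 at the head of `t`, and the 0 at the head of `s` finds
no partner in `v`. -/
theorem SGap.of_append {u v s t : List ℕ} (h : SGap (u ++ s) (v ++ t))
    (hu : ∀ a ∈ u, 0 < a) (hv : ∀ a ∈ v, 0 < a) (hs : ∀ a ∈ s.head?, a = 0)
    (ht : ∀ a ∈ t.head?, a = 0) : SGap u v ∧ SGap s t := by
  induction v generalizing u with
  | nil =>
    cases u with
    | nil => exact ⟨.nil _, h⟩
    | cons a u =>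
      have ha := hu a List.mem_cons_self
      cases t with
      | nil => exact nomatch h
      | cons b t =>
        obtain rfl := ht b rfl
        cases h with
        | cons => exact (Nat.lt_irrefl _ ha).elim
        | skip hab => exact (Nat.not_lt.2 hab ha).elim
  | cons b v ih =>
    have hb := hv b List.mem_cons_self
    have hv' : ∀ a ∈ v, 0 < a := fun a ha => hv a (List.mem_cons_of_mem _ ha)
    cases u with
    | nil =>
      refine ⟨.nil _, ?_⟩
      cases s with
      | nil => exact .nil _
      | cons a s =>
        obtain rfl := hs a rfl
        cases h with
        | cons => exact (Nat.lt_irrefl _ hb).elim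
        | skip _ h => exact (ih (u := []) h hu hv').2
    | cons a u =>
      cases h with
      | cons _ h =>
        have := ih h (fun a ha => hu a (List.mem_cons_of_mem _ ha)) hv'
        exact ⟨.cons _ this.1, this.2⟩
      | skip hab h =>
        have := ih (u := a :: u) h hu hv'
        exact ⟨.skip hab this.1, this.2⟩

theorem sGap_map_succ {s t : List ℕ} : SGap (s.map (· + 1)) (t.map (· + 1)) ↔ SGap s t := by
  constructor
  · intro h
    induction t generalizing s with
    | nil =>
      cases s with
      | nil => exact .nil _
      | cons => exact nomatch h
    | cons b t ih =>
      cases s with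
      | nil => exact .nil _
      | cons a s =>
        rw [List.map_cons, List.map_cons] at h
        generalize ha : a + 1 = a', hb : b + 1 = b' at h
        cases h with
        | cons _ h =>
          obtain rfl : a = b := by omega
          exact .cons a (ih h)
        | skip hab h =>
          subst ha
          exact .skip (by omega) (ih (s := a :: s) h)
  · intro h
    induction h with
    | nil => exact .nil _
    | cons a _ ih => exact .cons _ ih
    | skip hab _ ih => exact .skip (Nat.succ_le_succ hab) ih

/-- The sequence that is coded by an iterated list. -/
def It.seq : (n : ℕ) → It n → List ℕ
  | 0, _ => []
  | n + 1, l => List.flatMap (fun x => 0 :: (It.seq n x).map (· + 1)) l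

/-! ### Sequences as iterated lists -/

namespace It

theorem seq_nil (n : ℕ) : seq (n + 1) [] = [] := rfl

theorem seq_cons (n : ℕ) (x : It n) (l : List (It n)) :
    seq (n + 1) (x :: l) = 0 :: ((seq n x).map (· + 1) ++ seq (n + 1) l) := rfl

theorem head?_seq (n : ℕ) (x : It n) : ∀ a ∈ (seq n x).head?, a = 0 := by
  cases n with
  | zero => simp [seq]
  | succ n =>
    cases x with
    | nil => simp [seq_nil]
    | cons x l => simp [seq_cons]

theorem pos_of_mem_map_succ {s : List ℕ} : ∀ a ∈ s.map (· + 1), 0 < a := by simp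

theorem sGap_seq_iff (n : ℕ) (x y : It n) : SGap (seq n x) (seq n y) ↔ le n x y := by
  induction n with
  | zero => exact ⟨fun _ => trivial, fun _ => .nil _⟩
  | succ n ih =>
    constructor
    · intro h
      change List.SublistForall₂ (le n) x y
      change List (It n) at x y
      induction y generalizing x with
      | nil =>
        cases x with
        | nil => exact .nil
        | cons => exact nomatch h
      | cons b y ihy =>
        cases x with
        | nil => exact .nil
        | cons a x =>
          have hv := pos_of_mem_map_succ (s := seq n b)
          cases h with
          | cons _ h =>
            have := SGap.of_append h pos_of_mem_map_succ hv (head?_seq (n + 1) x)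
              (head?_seq (n + 1) y)
            exact .cons ((ih a b).1 (sGap_map_succ.1 this.1)) (ihy x this.2)
          | skip _ h =>
            have := SGap.of_append (u := []) (s := seq (n + 1) (a :: x)) h (by simp) hv
              (head?_seq (n + 1) (a :: x)) (head?_seq (n + 1) y)
            exact .cons_right (ihy (a :: x) this.2)
    · intro h
      change List.SublistForall₂ (le n) x y at h
      induction h with
      | nil => exact .nil _
      | cons hab _ ihl =>
        exact .cons 0 (SGap.append (sGap_map_succ.2 ((ih _ _).2 hab)) (head?_seq (n + 1) _) ihl)
      | @cons_right b x y _ ihl =>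
        rw [seq_cons, ← List.cons_append]
        exact SGap.append (u := []) (.nil _) (head?_seq (n + 1) x) ihl

theorem seq_injective (n : ℕ) : Function.Injective (seq n) := fun x y h =>
  antisymm_le ((sGap_seq_iff n x y).1 (h ▸ .refl _)) ((sGap_seq_iff n y x).1 (h ▸ .refl _))

theorem seq_mem (n : ℕ) (x : It n) : seq n x ∈ SBarInit n 0 := by
  refine ⟨?_, fun a ha => (head?_seq n x a ha).le⟩
  induction n with
  | zero => exact ⟨by simp [seq], by simp [seq]⟩
  | succ n ih =>
    change List (It n) at x
    induction x with
    | nil => exact ⟨by simp [seq], by simp [seq]⟩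
    | cons a x ihx =>
      rw [seq_cons]
      refine ⟨?_, ?_⟩
      · intro b hb
        rw [List.mem_cons, List.mem_append, List.mem_map] at hb
        rcases hb with rfl | ⟨c, hc, rfl⟩ | hb
        · exact Nat.succ_pos n
        · exact Nat.succ_lt_succ ((ih a).1 c hc)
        · exact ihx.1 b hb
      · have h₁ : ((seq n a).map (· + 1) ++ seq (n + 1) x).IsChain fun a b => b ≤ a + 1 := by
          rw [List.isChain_append]
          refine ⟨?_, ihx.2, ?_⟩
          · rw [List.isChain_map]
            exact (ih a).2.imp fun _ _ h => Nat.succ_le_succ h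
          · intro b _ c hc
            rw [head?_seq (n + 1) x c hc]
            exact Nat.zero_le _
        rw [List.isChain_cons]
        refine ⟨?_, h₁⟩
        intro b hb
        rw [List.head?_append, Option.mem_def, Option.or_eq_some_iff] at hb
        rcases hb with hb | ⟨-, hb⟩
        · rw [List.head?_map, Option.map_eq_some_iff] at hb
          obtain ⟨c, hc, rfl⟩ := hb
          rw [head?_seq n a c hc]
        · rw [head?_seq (n + 1) x b hb]
          exact Nat.zero_le _

theorem exists_map_succ {s : List ℕ} (h : ∀ a ∈ s, 0 < a) : ∃ t : List ℕ, s = t.map (· + 1) := by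
  refine ⟨s.map (· - 1), ?_⟩
  rw [List.map_map, List.map_congr_left (g := id), List.map_id]
  exact fun a ha => Nat.sub_add_cancel (h a ha)

theorem exists_seq_eq (n : ℕ) {s : List ℕ} (hs : s ∈ SBarInit n 0) : ∃ x, seq n x = s := by
  induction n generalizing s with
  | zero =>
    refine ⟨PUnit.unit, ?_⟩
    cases s with
    | nil => rfl
    | cons a s => exact (Nat.not_lt_zero _ (hs.1.1 a List.mem_cons_self)).elim
  | succ n ih =>
    generalize hk : s.length = k
    induction k using Nat.strong_induction_on generalizing s with
    | _ k ihk =>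
    cases s with
    | nil => exact ⟨[], rfl⟩
    | cons a s =>
      obtain ⟨⟨hlt, hch⟩, hhd⟩ := hs
      obtain rfl : a = 0 := Nat.le_zero.1 (hhd a rfl)
      rw [List.isChain_cons] at hch
      obtain ⟨hhead, hch⟩ := hch
      have hsplit := List.takeWhile_append_dropWhile (p := fun x => decide (0 < x)) (l := s)
      set u := s.takeWhile fun x => decide (0 < x) with hu
      set v := s.dropWhile fun x => decide (0 < x) with hv
      have hupos : ∀ a ∈ u, 0 < a := fun a ha => by simpa using List.mem_takeWhile_imp ha
      have hvhd : ∀ a ∈ v.head?, a ≤ 0 := by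
        intro a ha
        have := List.head?_dropWhile_not (fun x => decide (0 < x)) s
        rw [← hv, ha] at this
        simpa using this
      rw [← hsplit, List.isChain_append] at hch
      obtain ⟨t, ht⟩ := exists_map_succ hupos
      have htmem : t ∈ SBarInit n 0 := by
        refine ⟨⟨fun a ha => ?_, ?_⟩, fun a ha => ?_⟩
        · have h : a + 1 ∈ s := by
            rw [← hsplit, ht]
            exact List.mem_append_left _ (List.mem_map_of_mem (f := (· + 1)) ha)
          exact Nat.lt_of_succ_lt_succ (hlt _ (List.mem_cons_of_mem _ h))
        · have := hch.1
          rw [ht, List.isChain_map] at this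
          exact this.imp fun _ _ h => Nat.le_of_succ_le_succ h
        -- The entry `a + 1` directly follows a 0, so the growth condition forces `a = 0`.
        · have h : a + 1 ∈ s.head? := by
            rw [← hsplit, ht, List.head?_append, List.head?_map, Option.mem_def.1 ha]
            rfl
          have := hhead _ h
          omega
      have hvmem : v ∈ SBarInit (n + 1) 0 := by
        refine ⟨⟨fun a ha => ?_, hch.2.1⟩, hvhd⟩
        exact hlt a (List.mem_cons_of_mem _ (hsplit ▸ List.mem_append_right _ ha))
      obtain ⟨x, hx⟩ := ih htmem
      have hlen : v.length < k := by
        rw [← hk]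
        exact Nat.lt_succ_of_le (List.dropWhile_suffix _).length_le
      obtain ⟨l, hl⟩ := ihk _ hlen hvmem rfl
      exact ⟨x :: l, (seq_cons n x l).trans (by rw [hx, hl, ← ht, hsplit])⟩

end It

/-! ### Shifts of theta terms -/

namespace Term

/-- Raises all indices of a term by one. -/
def shift : Term → Term
  | zero => zero
  | theta i α β => theta (i + 1) (shift α) (shift β)

theorem shift_injective : Function.Injective shift := by
  intro α
  induction α with
  | zero =>
    intro β h
    cases β with
    | zero => rfl
    | theta => exact nomatch h
  | theta i α β ihα ihβ =>
    intro γ h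
    cases γ with
    | zero => exact nomatch h
    | theta j γ δ =>
      simp only [shift, theta.injEq, Nat.add_right_cancel_iff] at h
      rw [h.1, ihα h.2.1, ihβ h.2.2]

theorem K_succ_shift (j : ℕ) (α : Term) : K (j + 1) (shift α) = shift '' K j α := by
  induction α with
  | zero => simp [shift, K]
  | theta i α β ihα ihβ =>
    rw [shift, K, K, ihα, ihβ]
    by_cases h : j < i
    · rw [if_pos h, if_pos (Nat.succ_lt_succ h), Set.image_union]
    · rw [if_neg h, if_neg fun h' => h (Nat.lt_of_succ_lt_succ h'), Set.image_singleton, shift]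

/-- This is what removes the conditions on `K` when terms of index 0 are compared. -/
theorem K_zero_shift (α : Term) : K 0 (shift α) = ∅ := by
  induction α with
  | zero => rfl
  | theta i α β ihα ihβ => rw [shift, K, if_pos (Nat.succ_pos i), ihα, ihβ, Set.union_empty]

theorem not_lt_zero (α : Term) : ¬ Lt α zero := by
  cases α <;> simp [Lt]

theorem zero_lt_theta (i : ℕ) (α β : Term) : Lt zero (theta i α β) := by
  simp [Lt]

theorem theta_lt_theta {i j : ℕ} {α β γ δ : Term} :
    Lt (theta i α β) (theta j γ δ) ↔ i < j ∨ (i = j ∧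
      ((Lt α γ ∧ (∀ ξ, ξ ∈ K i α → Lt ξ (theta j γ δ)) ∧ Lt β (theta j γ δ)) ∨
       (α = γ ∧ Lt β δ) ∨
       (Lt γ α ∧ (∀ ξ, ξ ∈ K i γ → (theta i α β = ξ ∨ Lt (theta i α β) ξ)) ∧
         (theta i α β = δ ∨ Lt (theta i α β) δ)))) := by
  rw [Lt]

theorem lt_shift_iff (α β : Term) : Lt (shift α) (shift β) ↔ Lt α β := by
  generalize hn : size α + size β = n
  induction n using Nat.strong_induction_on generalizing α β with
  | _ n ih =>
  subst hn
  cases β with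
  | zero => exact iff_of_false (not_lt_zero _) (not_lt_zero _)
  | theta j γ δ =>
    cases α with
    | zero => exact iff_of_true (zero_lt_theta _ _ _) (zero_lt_theta _ _ _)
    | theta i α β =>
      have ih' : ∀ ξ η, size ξ + size η < size (theta i α β) + size (theta j γ δ) →
          (Lt (shift ξ) (shift η) ↔ Lt ξ η) := fun ξ η h => ih _ h ξ η rfl
      have hα : ∀ ξ ∈ K i α, (Lt (shift ξ) (shift (theta j γ δ)) ↔ Lt ξ (theta j γ δ)) := by
        intro ξ hξ
        have := size_le_of_mem_K hξ
        exact ih' _ _ (by simp only [size]; omega)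
      have hγ : ∀ ξ ∈ K i γ, (Lt (shift (theta i α β)) (shift ξ) ↔ Lt (theta i α β) ξ) := by
        intro ξ hξ
        have := size_le_of_mem_K hξ
        exact ih' _ _ (by simp only [size]; omega)
      have h₁ := ih' α γ (by simp only [size]; omega)
      have h₂ := ih' β (theta j γ δ) (by simp only [size]; omega)
      have h₃ := ih' β δ (by simp only [size]; omega)
      have h₄ := ih' γ α (by simp only [size]; omega)
      have h₅ := ih' (theta i α β) δ (by simp only [size]; omega)
      have e₁ : (∀ ξ, ξ ∈ K (i + 1) (shift α) → Lt ξ (shift (theta j γ δ))) ↔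
          ∀ ξ, ξ ∈ K i α → Lt ξ (theta j γ δ) := by
        rw [K_succ_shift, Set.forall_mem_image]
        exact forall₂_congr fun ξ hξ => hα ξ hξ
      have e₂ : (∀ ξ, ξ ∈ K (i + 1) (shift γ) →
          (shift (theta i α β) = ξ ∨ Lt (shift (theta i α β)) ξ)) ↔
          ∀ ξ, ξ ∈ K i γ → (theta i α β = ξ ∨ Lt (theta i α β) ξ) := by
        rw [K_succ_shift, Set.forall_mem_image]
        exact forall₂_congr fun ξ hξ => by rw [hγ ξ hξ, shift_injective.eq_iff]
      have h₆ : shift (theta i α β) = shift δ ↔ theta i α β = δ := shift_injective.eq_iff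
      have h₇ : shift α = shift γ ↔ α = γ := shift_injective.eq_iff
      rw [theta_lt_theta, ← e₁, ← e₂, ← h₁, ← h₂, ← h₃, ← h₄, ← h₅, ← h₆, ← h₇]
      simp only [shift]
      rw [theta_lt_theta, Nat.succ_lt_succ_iff, Nat.add_right_cancel_iff]

/-- Shifting raises `S` by one except at `zero`, where it stays `-1`; for `0 ≤ k` both sides hold
there anyway. -/
theorem S_shift_le {α : Term} {k : ℤ} (hk : 0 ≤ k) : S (shift α) ≤ k + 1 ↔ S α ≤ k := by
  cases α with
  | zero => simp only [shift, S]; omega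
  | theta i α β => simp only [shift, S]; push_cast; omega

/-- The order between terms with index `0`. -/
theorem theta_zero_shift_lt_iff {α β γ δ : Term} :
    Lt (theta 0 (shift α) β) (theta 0 (shift γ) δ) ↔
      (Lt α γ ∧ Lt β (theta 0 (shift γ) δ)) ∨ (α = γ ∧ Lt β δ) ∨
      (Lt γ α ∧ (theta 0 (shift α) β = δ ∨ Lt (theta 0 (shift α) β) δ)) := by
  rw [theta_lt_theta]
  simp only [K_zero_shift, lt_shift_iff, shift_injective.eq_iff, Set.mem_empty_iff_false]
  simp

end Term

open Term

/-! ### Theta terms as iterated lists -/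

theorem OT.shift {n : ℕ} {α : Term} (h : OT n α) : OT (n + 1) α.shift := by
  induction h with
  | zero => exact .zero
  | @theta i α β _ _ hSα hSβ hi hK ihα ihβ =>
    refine .theta ihα ihβ ?_ ?_ (Nat.succ_lt_succ hi) ?_
    · push_cast
      exact (S_shift_le (by omega)).2 hSα
    · push_cast
      exact (S_shift_le (by omega)).2 hSβ
    · rw [K_succ_shift, hK, Set.image_empty]

/-- The set `K 0` collects the outermost subterms of index 0. If there are none, all indices are
positive and can be lowered. -/
theorem OT.exists_shift {n : ℕ} {α : Term} (h : OT (n + 1) α) (hK : K 0 α = ∅) :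
    ∃ β, α = β.shift ∧ OT n β := by
  induction h with
  | zero => exact ⟨.zero, rfl, .zero⟩
  | @theta i α β _ _ hSα hSβ hi hKi ihα ihβ =>
    rw [K] at hK
    split_ifs at hK with h
    · rw [Set.union_empty_iff] at hK
      obtain ⟨α', rfl, hα'⟩ := ihα hK.1
      obtain ⟨β', rfl, hβ'⟩ := ihβ hK.2
      obtain ⟨j, rfl⟩ : ∃ j, i = j + 1 := ⟨i - 1, by omega⟩
      push_cast at hSα hSβ
      refine ⟨.theta j α' β', rfl, .theta hα' hβ' ((S_shift_le (by omega)).1 hSα)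
        ((S_shift_le (by omega)).1 hSβ) (Nat.lt_of_succ_lt_succ hi) ?_⟩
      rw [K_succ_shift] at hKi
      exact Set.image_eq_empty.1 hKi
    · exact (Set.singleton_ne_empty _ hK).elim

theorem S_le_zero_iff {α : Term} : S α ≤ 0 ↔ Term.Lt α (.theta 1 .zero .zero) := by
  cases α with
  | zero => exact iff_of_true (by simp [S]) (zero_lt_theta _ _ _)
  | theta i α β =>
    rw [theta_lt_theta]
    simp [S, not_lt_zero]

theorem toTerm_map_succ (s : List ℕ) : toTerm (s.map (· + 1)) = (toTerm s).shift := by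
  generalize hn : s.length = n
  induction n using Nat.strong_induction_on generalizing s with
  | _ n ih =>
  subst hn
  cases s with
  | nil => simp [toTerm, Term.shift]
  | cons a s =>
    have hp : ((fun x => decide (a + 1 < x)) ∘ fun x => x + 1) = fun x => decide (a < x) := by
      funext x
      simp
    rw [List.map_cons, toTerm, toTerm, Term.shift, List.takeWhile_map, List.dropWhile_map, hp,
      ih _ (Nat.lt_succ_of_le (List.takeWhile_prefix _).length_le) _ rfl,
      ih _ (Nat.lt_succ_of_le (List.dropWhile_suffix _).length_le) _ rfl]

/-- The term that is coded by an iterated list. -/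
def It.term : (n : ℕ) → It n → Term
  | 0, _ => .zero
  | n + 1, l => List.foldr (fun x t => .theta 0 (It.term n x).shift t) .zero l

namespace It

theorem term_nil (n : ℕ) : term (n + 1) [] = .zero := rfl

theorem term_cons (n : ℕ) (x : It n) (l : List (It n)) :
    term (n + 1) (x :: l) = .theta 0 (term n x).shift (term (n + 1) l) := rfl

theorem toTerm_seq (n : ℕ) (x : It n) : toTerm (seq n x) = term n x := by
  induction n with
  | zero => simp [seq, term, toTerm]
  | succ n ih =>
    change List (It n) at x
    induction x with
    | nil => rw [seq_nil, term_nil, toTerm]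
    | cons a x ihx =>
      have hpos : ∀ b ∈ (seq n a).map (· + 1), decide (0 < b) = true := by simp
      have hhd : (seq (n + 1) x).takeWhile (fun b => decide (0 < b)) = [] ∧
          (seq (n + 1) x).dropWhile (fun b => decide (0 < b)) = seq (n + 1) x := by
        have := head?_seq (n + 1) x
        generalize seq (n + 1) x = s at this
        cases s with
        | nil => exact ⟨rfl, rfl⟩
        | cons b s =>
          obtain rfl := this b rfl
          simp
      rw [seq_cons, term_cons, toTerm, List.takeWhile_append_of_pos hpos,
        List.dropWhile_append_of_pos hpos, hhd.1, hhd.2, List.append_nil, toTerm_map_succ, ih, ihx]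

theorem term_injective (n : ℕ) : Function.Injective (term n) := by
  induction n with
  | zero => exact fun _ _ _ => rfl
  | succ n ih =>
    intro x y h
    change List (It n) at x y
    induction x generalizing y with
    | nil =>
      cases y with
      | nil => rfl
      | cons => exact nomatch h
    | cons a x ihx =>
      cases y with
      | nil => exact nomatch h
      | cons b y =>
        rw [term_cons, term_cons, Term.theta.injEq] at h
        exact congrArg₂ List.cons (ih (shift_injective h.2.1)) (ihx h.2.2)

theorem lt_term_iff (n : ℕ) (x y : It n) : Term.Lt (term n x) (term n y) ↔ lt n x y := by
  induction n with
  | zero => exact iff_of_false (not_lt_zero _) fun h => h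
  | succ n ih =>
    change Term.Lt (term (n + 1) x) (term (n + 1) y) ↔ Lpo (lt n) x y
    change List (It n) at x y
    induction x generalizing y with
    | nil =>
      cases y with
      | nil => exact iff_of_false (not_lt_zero _) fun h => nomatch h
      | cons c d => exact iff_of_true (zero_lt_theta _ _ _) (.nil_lt c d)
    | cons a b ihb =>
      induction y with
      | nil => exact iff_of_false (not_lt_zero _) fun h => nomatch h
      | cons c d ihd =>
        have h₁ := ihb (c :: d)
        rw [term_cons] at ihd h₁
        have h₂ : Term.theta 0 (term n a).shift (term (n + 1) b) = term (n + 1) d ↔ a :: b = d :=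
          (term_injective (n + 1)).eq_iff (a := a :: b) (b := d)
        rw [term_cons, term_cons, theta_zero_shift_lt_iff,
          Lpo.cons_iff fun a b => trichotomous_of (lt n) a b, ih, ih, ihb, ihd, h₁, h₂,
          (term_injective n).eq_iff]

theorem term_mem (n : ℕ) (x : It n) : term n x ∈ OTZero n := by
  have hS : ∀ n (x : It n), S (term n x) ≤ 0 := by
    intro n x
    cases n with
    | zero => exact (by decide : (-1 : ℤ) ≤ 0)
    | succ n =>
      cases x with
      | nil => exact (by decide : (-1 : ℤ) ≤ 0)
      | cons a x => exact le_rfl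
  refine ⟨?_, S_le_zero_iff.1 (hS n x)⟩
  induction n with
  | zero => exact .zero
  | succ n ih =>
    change List (It n) at x
    induction x with
    | nil => exact .zero
    | cons a x ihx =>
      exact .theta (ih a).shift ihx ((S_shift_le le_rfl).2 (hS n a)) (hS (n + 1) x)
        (Nat.succ_pos n) (K_zero_shift _)

theorem exists_term_eq (n : ℕ) {α : Term} (h : α ∈ OTZero n) : ∃ x, term n x = α := by
  obtain ⟨h, hlt⟩ := h
  rw [← S_le_zero_iff] at hlt
  induction n generalizing α with
  | zero =>
    cases h with
    | zero => exact ⟨PUnit.unit, rfl⟩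
    | theta _ _ _ _ hi _ => exact (Nat.not_lt_zero _ hi).elim
  | succ n ih =>
    induction h with
    | zero => exact ⟨[], rfl⟩
    | @theta i α β hα _ hSα hSβ hi hK _ ihβ =>
      obtain rfl : i = 0 := by
        simp only [S] at hlt
        omega
      obtain ⟨α', rfl, hα'⟩ := hα.exists_shift hK
      obtain ⟨x, rfl⟩ := ih hα' ((S_shift_le le_rfl).1 hSα)
      obtain ⟨l, rfl⟩ := ihβ hSβ
      exact ⟨x :: l, rfl⟩

end It

/-! ### The maximal linear extension -/

namespace It

/-- The sequences that are coded by iterated lists. -/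
noncomputable def seqEquiv (n : ℕ) : It n ≃ SBarInit n 0 :=
  Equiv.ofBijective (fun x => ⟨seq n x, seq_mem n x⟩)
    ⟨fun _ _ h => seq_injective n (congrArg Subtype.val h), fun s =>
      (exists_seq_eq n s.2).imp fun _ h => Subtype.ext h⟩

/-- The terms that are coded by iterated lists. -/
noncomputable def termEquiv (n : ℕ) : It n ≃ OTZero n :=
  Equiv.ofBijective (fun x => ⟨term n x, term_mem n x⟩)
    ⟨fun _ _ h => term_injective n (congrArg Subtype.val h), fun α =>
      (exists_term_eq n α.2).imp fun _ h => Subtype.ext h⟩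

end It

/-- The order of the terms, read on sequences. -/
def seqLt (n : ℕ) (s t : SBarInit n 0) : Prop := Term.Lt (toTerm s.1) (toTerm t.1)

theorem strongGap_seqEquiv_iff (n : ℕ) (x y : It n) :
    strongGap n 0 (It.seqEquiv n x) (It.seqEquiv n y) ↔ It.le n x y :=
  strongGapLE_iff_sGap.trans (It.sGap_seq_iff n x y)

theorem weakGap_eq_strongGap (n : ℕ) : weakGap n 0 = strongGap n 0 := by
  funext s t
  exact propext (weakGapLE_iff_strongGapLE s.2.2)

/-- The isomorphism between iterated lists and sequences, for the linear orders. -/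
noncomputable def seqRelIso (n : ℕ) : It.lt n ≃r seqLt n where
  toEquiv := It.seqEquiv n
  map_rel_iff' {x y} := by
    change Term.Lt (toTerm (It.seq n x)) (toTerm (It.seq n y)) ↔ _
    rw [It.toTerm_seq, It.toTerm_seq, It.lt_term_iff]

/-- The isomorphism between iterated lists and terms. -/
noncomputable def termRelIso (n : ℕ) : It.lt n ≃r otLt n where
  toEquiv := It.termEquiv n
  map_rel_iff' {x y} := It.lt_term_iff n x y

instance isWellOrder_seqLt (n : ℕ) : IsWellOrder (SBarInit n 0) (seqLt n) :=
  (seqRelIso n).symm.toRelEmbedding.isWellOrder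

instance isWellOrder_otLt (n : ℕ) : IsWellOrder (OTZero n) (otLt n) :=
  (termRelIso n).symm.toRelEmbedding.isWellOrder

theorem type_seqLt (n : ℕ) : Ordinal.type (seqLt n) = ω ^ It.exponent n := by
  rw [← It.type_lt]
  exact type_eq.2 ⟨(seqRelIso n).symm⟩

theorem type_otLt (n : ℕ) : Ordinal.type (otLt n) = ω ^ It.exponent n := by
  rw [← It.type_lt]
  exact type_eq.2 ⟨(termRelIso n).symm⟩

theorem isWPO_strongGap (n : ℕ) : IsWPO (strongGap n 0) := by
  have := It.isPreorder_le n
  have key : ∀ s t : SBarInit n 0, strongGap n 0 s t ↔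
      It.le n ((It.seqEquiv n).symm s) ((It.seqEquiv n).symm t) := fun s t => by
    rw [← strongGap_seqEquiv_iff, Equiv.apply_symm_apply, Equiv.apply_symm_apply]
  refine ⟨{ refl := fun s => (key s s).2 (refl_of (It.le n) _)
            trans := fun s t u h h' =>
              (key s u).2 (trans_of (It.le n) ((key s t).1 h) ((key t u).1 h'))
            antisymm := fun s t h h' =>
              (It.seqEquiv n).symm.injective (It.antisymm_le ((key s t).1 h) ((key t s).1 h')) },
    fun f => ?_⟩
  obtain ⟨i, j, hij, h⟩ := It.wellQuasiOrdered_le n fun k => (It.seqEquiv n).symm (f k)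
  exact ⟨i, j, hij, (key _ _).2 h⟩

theorem extends_seqLt (n : ℕ) : Extends (strongGap n 0) (seqLt n) := by
  intro s t h
  obtain ⟨x, rfl⟩ := (It.seqEquiv n).surjective s
  obtain ⟨y, rfl⟩ := (It.seqEquiv n).surjective t
  rcases It.extends_lt n x y ((strongGap_seqEquiv_iff n x y).1 h) with rfl | h
  · exact Or.inl rfl
  · exact Or.inr ((seqRelIso n).map_rel_iff.2 h)

theorem maxOrderType_strongGap (n : ℕ) : maxOrderType (strongGap n 0) = ω ^ It.exponent n := by
  refine le_antisymm (csSup_le ⟨_, seqLt n, inferInstance, extends_seqLt n, rfl⟩ ?_) ?_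
  · rintro _ ⟨lt, _, hext, rfl⟩
    have e : (It.seqEquiv n ⁻¹'o lt) ≃r lt := RelIso.preimage (It.seqEquiv n) lt
    have := e.toRelEmbedding.isWellOrder
    rw [← type_eq.2 ⟨e⟩]
    -- An arbitrary linear extension is pulled back to `It n`, where the bound by residuals holds.
    refine It.type_le_of_extends n _ fun x y h => ?_
    rcases hext _ _ ((strongGap_seqEquiv_iff n x y).2 h) with h' | h'
    · exact Or.inl ((It.seqEquiv n).injective h')
    · exact Or.inr h'
  · rw [← type_seqLt]
    exact le_csSup (bddAbove_extensionTypes _) ⟨seqLt n, inferInstance, extends_seqLt n, rfl⟩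

theorem isMaximalLinearExtension_seqLt (n : ℕ) :
    IsMaximalLinearExtension (strongGap n 0) (seqLt n) :=
  ⟨inferInstance, extends_seqLt n, (type_seqLt n).trans (maxOrderType_strongGap n).symm⟩

theorem bijOn_toTerm (n : ℕ) : Set.BijOn toTerm (SBarInit n 0) (OTZero n) := by
  refine ⟨?_, ?_, ?_⟩
  · intro s hs
    obtain ⟨x, rfl⟩ := It.exists_seq_eq n hs
    rw [It.toTerm_seq]
    exact It.term_mem n x
  · intro s hs t ht h
    obtain ⟨x, rfl⟩ := It.exists_seq_eq n hs
    obtain ⟨y, rfl⟩ := It.exists_seq_eq n ht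
    rw [It.toTerm_seq, It.toTerm_seq] at h
    rw [It.term_injective n h]
  · intro α hα
    obtain ⟨x, rfl⟩ := It.exists_term_eq n hα
    exact ⟨It.seq n x, It.seq_mem n x, It.toTerm_seq n x⟩

end GapTheta

theorem mainTheorem5 (n : ℕ) :
    -- the weak and the strong relation agree, and are a well-partial-order
    (∀ s t : GapTheta.SBarInit n 0, GapTheta.weakGap n 0 s t ↔ GapTheta.strongGap n 0 s t) ∧
    GapTheta.IsWPO (GapTheta.weakGap n 0) ∧
    GapTheta.IsWPO (GapTheta.strongGap n 0) ∧
    -- the map identifies the underlying sets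
    Set.BijOn GapTheta.toTerm (GapTheta.SBarInit n 0) (GapTheta.OTZero n) ∧
    -- the order of the terms, read on sequences, is a maximal linear extension
    GapTheta.IsMaximalLinearExtension (GapTheta.weakGap n 0)
      (fun s t => GapTheta.Term.Lt (GapTheta.toTerm s.1) (GapTheta.toTerm t.1)) ∧
    GapTheta.IsMaximalLinearExtension (GapTheta.strongGap n 0)
      (fun s t => GapTheta.Term.Lt (GapTheta.toTerm s.1) (GapTheta.toTerm t.1)) ∧
    -- the order types
    ∃ _ : IsWellOrder (GapTheta.OTZero n) (GapTheta.otLt n),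
      Ordinal.type (GapTheta.otLt n) = GapTheta.maxOrderType (GapTheta.weakGap n 0) ∧
      Ordinal.type (GapTheta.otLt n) = GapTheta.maxOrderType (GapTheta.strongGap n 0) ∧
      (1 ≤ n → Ordinal.type (GapTheta.otLt n) = GapTheta.omegaTower (2 * n - 1) 1) := by
  open GapTheta in
  rw [weakGap_eq_strongGap]
  exact ⟨fun _ _ => Iff.rfl, isWPO_strongGap n, isWPO_strongGap n, bijOn_toTerm n,
    isMaximalLinearExtension_seqLt n, isMaximalLinearExtension_seqLt n, isWellOrder_otLt n,
    (type_otLt n).trans (maxOrderType_strongGap n).symm,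
    (type_otLt n).trans (maxOrderType_strongGap n).symm, fun hn => by
      obtain ⟨m, rfl⟩ := Nat.exists_eq_add_of_le' hn
      exact (type_otLt _).trans (It.omega0_opow_exponent m)⟩
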